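/- Let $\mathbb{D}$ be the open unit disk and $\mathbb{T}$ the unit circle in $\mathbb{C}$, and let $\Gamma\subseteq\mathbb{T}$ be a closed set (possibly empty). Then there is a Hilbert space $\mathcal{H}\subseteq\operatorname{Hol}(\mathbb{D})$ of holomorphic functions on $\mathbb{D}$ such that - **(P1)** the polynomials in one complex variable belong to $\mathcal{H}$ and are dense in it; - **(P2)** for each $w\in\mathbb{D}$ the evaluation functional $F\mapsto F(w)$ is continuous on $\mathcal{H}$; - **(P3)** the shift operator $F\mapsto zF$ maps $\mathcal{H}$ to itself and is continuous; and whose maximal domain $$\Omega_{max}:=\{w\in\mathbb{C} : \text{the functional } P\mapsto P(w) \text{ on polynomials extends to a continuous linear functional on } \mathcal{H}\}$$ is $\Omega_{max}=\mathbb{D}\cup\Gamma$. Moreover, if $\Gamma\neq\emptyset$, one can take $\mathcal{H}=\mathcal{H}_{v,2}$ with $$v(z)=\exp\left(-\frac{\operatorname{dist}(z/|z|,\Gamma)}{1-|z|}\right),\qquad z\in\mathbb{D}\setminus\{0\},$$ where $$\mathcal{H}_{v,2}=\Big\{F\in\operatorname{Hol}(\mathbb{D}) : \|F\|_{v,2}^2:=\sum_{k=0}^{2}\int_{\mathbb{D}}|F^{(k)}|^2\,v\,dA<\infty\Big\},\qquad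 dA=\frac{dx\,dy}{\pi},$$ with the norm $\|\cdot\|_{v,2}$. This $v$ is an admissible weight: $v\in L^1(\mathbb{D},dA)$; for every $0<r<1$ there is $\delta_r>0$ with $v(z)>\delta_r$ for a.e. $z\in r\mathbb{D}$; and for every $0<r<1$, $v(z)\le v(rz)$ for a.e. $z\in\mathbb{D}$. -/

import Mathlib

open MeasureTheory
open scoped ENNReal

/-- The open unit disk. -/
abbrev unitDisk : Set ℂ := Metric.ball 0 1

/-- Extension by zero of a function on `Ω` to the whole plane; on an open set `Ω` the derivatives
at points of `Ω` do not depend on the extension. -/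
noncomputable def extendZero {Ω : Set ℂ} (f : Ω → ℂ) : ℂ → ℂ :=
  Function.extend Subtype.val f 0

theorem extendZero_apply {Ω : Set ℂ} (f : Ω → ℂ) (z : Ω) : extendZero f z = f z :=
  Subtype.val_injective.extend_apply f 0 z

/-- The vector space `Hol(Ω)` of holomorphic functions on an open set `Ω ⊆ ℂ`. -/
noncomputable def Hol (Ω : Set ℂ) : Submodule ℂ (Ω → ℂ) where
  carrier := {f | DifferentiableOn ℂ (extendZero f) Ω}
  add_mem' {f g} hf hg := by
    refine (DifferentiableOn.add hf hg).congr fun z hz => ?_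
    have h1 := extendZero_apply f ⟨z, hz⟩
    have h2 := extendZero_apply g ⟨z, hz⟩
    have h3 := extendZero_apply (f + g) ⟨z, hz⟩
    simp_all
  zero_mem' := by
    refine (differentiableOn_const (0 : ℂ)).congr fun z hz => ?_
    simpa using extendZero_apply (0 : Ω → ℂ) ⟨z, hz⟩
  smul_mem' c f hf := by
    refine (DifferentiableOn.const_smul hf c).congr fun z hz => ?_
    have h1 := extendZero_apply f ⟨z, hz⟩
    have h2 := extendZero_apply (c • f) ⟨z, hz⟩
    simp_all

/-- A polynomial in one complex variable, as a holomorphic function on `Ω`. -/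
noncomputable def polyHol (Ω : Set ℂ) (p : Polynomial ℂ) : Hol Ω :=
  ⟨fun z => p.eval (z : ℂ), by
    refine (p.differentiable.differentiableOn).congr fun z hz => ?_
    exact extendZero_apply (fun z : Ω => p.eval (z : ℂ)) ⟨z, hz⟩⟩

/-! A topological vector space of holomorphic functions on `Ω` is given by a topological vector
space `X` together with an injective linear map `ι : X →ₗ[ℂ] Hol Ω`, the inclusion. -/

section FunctionSpace

variable {Ω : Set ℂ} {X : Type*} [AddCommGroup X] [Module ℂ X] [TopologicalSpace X]

/-- The polynomials belong to the space and form a dense subset of it. -/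
def PolynomialsDense (ι : X →ₗ[ℂ] Hol Ω) : Prop :=
  (∀ p : Polynomial ℂ, ∃ F : X, ι F = polyHol Ω p) ∧
    Dense {F : X | ∃ p : Polynomial ℂ, ι F = polyHol Ω p}

/-- The evaluation functional at each point of `Ω` is continuous. -/
def EvaluationsContinuous (ι : X →ₗ[ℂ] Hol Ω) : Prop :=
  ∀ w : Ω, Continuous fun F : X => (ι F : Ω → ℂ) w

/-- Multiplication by the coordinate `z` is a well-defined continuous operator on the space. -/
def ShiftContinuous (ι : X →ₗ[ℂ] Hol Ω) : Prop :=
  ∃ S : X →L[ℂ] X, ∀ (F : X) (z : Ω), (ι (S F) : Ω → ℂ) z = (z : ℂ) * (ι F : Ω → ℂ) z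

/-- The maximal domain: all `w ∈ ℂ` for which evaluation `p ↦ p(w)` on polynomials extends to a
continuous linear functional on the space. -/
def maximalDomain (ι : X →ₗ[ℂ] Hol Ω) : Set ℂ :=
  {w : ℂ | ∃ Λ : X →L[ℂ] ℂ, ∀ (p : Polynomial ℂ) (F : X), ι F = polyHol Ω p → Λ F = p.eval w}

end FunctionSpace

/-- The normalized area measure `dA = dx dy / π` on the unit disk. -/
noncomputable def areaMeasure : Measure ℂ :=
  ENNReal.ofReal Real.pi⁻¹ • volume.restrict unitDisk

/-- The admissible weights on the unit disk: `v ∈ L¹`, `v` is essentially bounded below by a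
positive constant on each smaller disk `r𝔻`, and `v(z) ≤ v(rz)` for almost every `z`, `0 < r < 1`. -/
structure IsAdmissibleWeight (v : ℂ → ℝ) : Prop where
  integrable : Integrable v areaMeasure
  lower_bound : ∀ r : ℝ, 0 < r → r < 1 →
    ∃ δ : ℝ, 0 < δ ∧ ∀ᵐ z ∂areaMeasure, ‖z‖ < r → δ < v z
  le_dilation : ∀ r : ℝ, 0 < r → r < 1 → ∀ᵐ z ∂areaMeasure, v z ≤ v ((r : ℂ) * z)

/-- `‖F‖²_{v,n} = ∑_{k ≤ n} ∫_𝔻 |F⁽ᵏ⁾|² v dA`, a value in `[0, ∞]`. -/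
noncomputable def weightedNormSq (v : ℂ → ℝ) (n : ℕ) (F : Hol unitDisk) : ℝ≥0∞ :=
  ∑ k ∈ Finset.range (n + 1),
    ∫⁻ z, ‖iteratedDeriv k (extendZero (F : unitDisk → ℂ)) z‖ₑ ^ 2 * ENNReal.ofReal (v z)
      ∂areaMeasure

/-- The normed space `H`, included in `Hol(𝔻)` through `ι`, is the space
`ℋ_{v,n} = {F ∈ Hol(𝔻) : ‖F‖_{v,n} < ∞}` with the norm `‖·‖_{v,n}`. -/
def IsWeightedSpace {H : Type*} [NormedAddCommGroup H] [InnerProductSpace ℂ H]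
    (ι : H →ₗ[ℂ] Hol unitDisk) (v : ℂ → ℝ) (n : ℕ) : Prop :=
  Set.range ι = {F : Hol unitDisk | weightedNormSq v n F < ∞} ∧
    ∀ F : H, ENNReal.ofReal (‖F‖ ^ 2) = weightedNormSq v n (ι F)

/-- The weight `v(z) = exp(-dist(z/|z|, Γ) / (1 - |z|))`, for nonempty `Γ`. -/
noncomputable def distWeight (Γ : Set ℂ) (z : ℂ) : ℝ :=
  Real.exp (-(Metric.infDist (z / (‖z‖ : ℂ)) Γ / (1 - ‖z‖)))

/-! The space is ℋ_{v,2} with v = `distWeight Γ`. The functional analysis uses only that v is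
positive, at most 1 on the disk, bounded below on smaller disks, and satisfies v(z) ≤ v(rz)
(`IsRegularWeight`). The sub-mean value property then bounds point evaluations locally uniformly, so
the jets (F, F', F'') form a closed subspace of a sum of L² spaces. Dilations F(r·) stay bounded in
norm and converge pointwise to F, hence weakly, and each is a norm limit of Taylor polynomials; this
gives density. The Leibniz rule bounds the shift.

The geometry of v decides which points of norm at least 1 are in the maximal domain. If w lies in Γ
and on the circle, v is bounded below on a Stolz angle with vertex w
(`ball_subset_and_le_distWeight`). At distance t from w along the radius this gives F'' = O(‖F‖/t),
and two integrations control the value at w (`exists_norm_eval_le`). One derivative fewer would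
leave F' = O(1/t) and a logarithmic divergence in this argument.

At any other w with |w| ≥ 1, the functions 1/(c - z) with c = (1 + ε)w have bounded norm as ε → 0:
the weight decays exponentially in 1/(1 - |z|) near w when |w| = 1, which beats the pole
(`exists_inv_norm_pow_mul_distWeight_le`). Their values 1/(εw) at w blow up, so evaluation at w is
unbounded (`notMem_maximalDomain`).

The construction works for any nonempty closed Γ in the plane, with Γ replaced by its trace on the
circle in the conclusion; a point off the circle therefore settles the case of empty Γ. -/

open Set Metric Filter Topology

/-! ### Sub-mean value inequalities -/

/-- The sub-mean value property of `|h|²` on circles, for `h` holomorphic. -/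
theorem sq_enorm_le_lintegral_circle {h : ℂ → ℂ} {z : ℂ} {ρ r : ℝ}
    (hh : DifferentiableOn ℂ h (ball z ρ)) (hr0 : 0 < r) (hr : r < ρ) :
    ENNReal.ofReal (2 * Real.pi) * ‖h z‖ₑ ^ 2 ≤
      ∫⁻ θ in Ioo (-Real.pi) Real.pi, ‖h (circleMap z r θ)‖ₑ ^ 2 := by
  -- h² is itself holomorphic, so its mean value property gives the bound for |h|² without
  -- Cauchy–Schwarz.
  have hd : DiffContOnCl ℂ (fun ζ => h ζ ^ 2) (ball z |r|) := by
    rw [abs_of_pos hr0]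
    exact ((hh.pow 2).mono (closure_ball_subset_closedBall.trans
      (closedBall_subset_ball hr))).diffContOnCl
  have h1 := hd.circleAverage
  rw [Real.circleAverage_def] at h1
  have hp : Function.Periodic (fun θ => h (circleMap z r θ) ^ 2) (2 * Real.pi) := fun θ => by
    simp only [periodic_circleMap z r θ]
  -- Circle averages run over [0, 2π], polar coordinates over (-π, π); periodicity moves the
  -- interval.
  have h2 := hp.intervalIntegral_add_eq 0 (-Real.pi)
  rw [zero_add, show -Real.pi + 2 * Real.pi = Real.pi by ring] at h2
  rw [h2] at h1
  have h3 : (2 * Real.pi) • (h z ^ 2) = ∫ θ in (-Real.pi)..Real.pi, h (circleMap z r θ) ^ 2 := by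
    rw [← h1, smul_smul, mul_inv_cancel₀ (by positivity), one_smul]
  calc ENNReal.ofReal (2 * Real.pi) * ‖h z‖ₑ ^ 2 = ‖(2 * Real.pi) • (h z ^ 2)‖ₑ := by
        rw [enorm_smul, enorm_pow, Real.enorm_of_nonneg (by positivity)]
    _ ≤ ∫⁻ θ in Ioc (-Real.pi) Real.pi, ‖h (circleMap z r θ) ^ 2‖ₑ := by
        rw [h3, intervalIntegral.integral_of_le (by linarith [Real.pi_pos])]
        exact enorm_integral_le_lintegral_enorm _
    _ = _ := by
        rw [setLIntegral_congr Ioo_ae_eq_Ioc.symm]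
        simp only [enorm_pow]

/-- The sub-mean value property of `|h|²` on disks, for `h` holomorphic. -/
theorem sq_enorm_le_lintegral_ball {h : ℂ → ℂ} {z : ℂ} {ρ : ℝ} (hρ : 0 < ρ)
    (hh : DifferentiableOn ℂ h (ball z ρ)) :
    ENNReal.ofReal (Real.pi * ρ ^ 2) * ‖h z‖ₑ ^ 2 ≤ ∫⁻ ζ in ball z ρ, ‖h ζ‖ₑ ^ 2 := by
  have hpol : ∀ p : ℝ × ℝ, z + Complex.polarCoord.symm p = circleMap z p.1 p.2 := fun p => by
    rw [Complex.polarCoord_symm_apply, circleMap, Complex.exp_mul_I]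
    push_cast
    ring
  have hmaps : ∀ p ∈ Ioo 0 ρ ×ˢ Ioo (-Real.pi) Real.pi, circleMap z p.1 p.2 ∈ ball z ρ := by
    rintro ⟨r, θ⟩ ⟨⟨h1, h2⟩, -⟩
    simpa [circleMap, abs_of_pos h1] using h2
  have hmeas : AEMeasurable (fun p : ℝ × ℝ => ENNReal.ofReal p.1 * ‖h (circleMap z p.1 p.2)‖ₑ ^ 2)
      (volume.restrict (Ioo 0 ρ ×ˢ Ioo (-Real.pi) Real.pi)) := by
    have hc : ContinuousOn (fun p : ℝ × ℝ => h (circleMap z p.1 p.2))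
        (Ioo 0 ρ ×ˢ Ioo (-Real.pi) Real.pi) :=
      hh.continuousOn.comp (by unfold circleMap; fun_prop) hmaps
    have hm := hc.aemeasurable (μ := volume) (measurableSet_Ioo.prod measurableSet_Ioo)
    exact (ENNReal.measurable_ofReal.comp measurable_fst).aemeasurable.mul (hm.enorm.pow_const 2)
  have hr : ∫⁻ r in Ioo 0 ρ, ENNReal.ofReal r = ENNReal.ofReal (ρ ^ 2 / 2) := by
    rw [← ofReal_integral_eq_lintegral_ofReal, ← integral_Ioc_eq_integral_Ioo,
      ← intervalIntegral.integral_of_le hρ.le, integral_id]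
    · simp
    · exact (continuous_id.integrableOn_Icc (a := 0) (b := ρ)).mono_set Ioo_subset_Icc_self
    · exact (ae_restrict_mem measurableSet_Ioo).mono fun r hr => hr.1.le
  calc ENNReal.ofReal (Real.pi * ρ ^ 2) * ‖h z‖ₑ ^ 2
      = ∫⁻ r in Ioo 0 ρ, ENNReal.ofReal r * (ENNReal.ofReal (2 * Real.pi) * ‖h z‖ₑ ^ 2) := by
        rw [lintegral_mul_const _ (by fun_prop), hr, ← mul_assoc,
          ← ENNReal.ofReal_mul (by positivity)]
        congr 2
        ring
    _ ≤ ∫⁻ r in Ioo 0 ρ, ENNReal.ofReal r *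
          ∫⁻ θ in Ioo (-Real.pi) Real.pi, ‖h (circleMap z r θ)‖ₑ ^ 2 := by
        refine setLIntegral_mono' measurableSet_Ioo fun r hr => ?_
        gcongr
        exact sq_enorm_le_lintegral_circle hh hr.1 hr.2
    _ = ∫⁻ r in Ioo 0 ρ, ∫⁻ θ in Ioo (-Real.pi) Real.pi,
          ENNReal.ofReal r * ‖h (circleMap z r θ)‖ₑ ^ 2 := by
        simp_rw [lintegral_const_mul' _ _ ENNReal.ofReal_ne_top]
    _ = ∫⁻ p in Ioo 0 ρ ×ˢ Ioo (-Real.pi) Real.pi,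
          ENNReal.ofReal p.1 * ‖h (circleMap z p.1 p.2)‖ₑ ^ 2 := by
        rw [Measure.volume_eq_prod, setLIntegral_prod _ (by rwa [← Measure.volume_eq_prod])]
    _ = ∫⁻ p in Ioo 0 ρ ×ˢ Ioo (-Real.pi) Real.pi, ENNReal.ofReal p.1 •
          (ball z ρ).indicator (fun ζ => ‖h ζ‖ₑ ^ 2) (z + Complex.polarCoord.symm p) := by
        refine setLIntegral_congr_fun (measurableSet_Ioo.prod measurableSet_Ioo) fun p hp => ?_
        simp only [hpol, indicator_of_mem (hmaps p hp), smul_eq_mul]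
    _ ≤ ∫⁻ p in Complex.polarCoord.target, ENNReal.ofReal p.1 •
          (ball z ρ).indicator (fun ζ => ‖h ζ‖ₑ ^ 2) (z + Complex.polarCoord.symm p) :=
        lintegral_mono_set (prod_mono Ioo_subset_Ioi_self le_rfl)
    _ = ∫⁻ ζ in ball z ρ, ‖h ζ‖ₑ ^ 2 := by
        refine (Complex.lintegral_comp_polarCoord_symm
          fun ζ => (ball z ρ).indicator (fun ζ => ‖h ζ‖ₑ ^ 2) (z + ζ)).trans ?_
        rw [lintegral_add_left_eq_self, lintegral_indicator measurableSet_ball]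

/-! ### Derivatives of holomorphic functions on the disk -/

theorem DifferentiableOn.iteratedDeriv_of_isOpen {f : ℂ → ℂ} {U : Set ℂ}
    (hf : DifferentiableOn ℂ f U) (hU : IsOpen U) (k : ℕ) :
    DifferentiableOn ℂ (iteratedDeriv k f) U := by
  induction k with
  | zero => simpa using hf
  | succ k ih => rw [iteratedDeriv_succ]; exact ih.deriv hU

theorem TendstoLocallyUniformlyOn.iteratedDeriv {f : ℕ → ℂ → ℂ} {g : ℂ → ℂ} {U : Set ℂ}
    (h : TendstoLocallyUniformlyOn f g atTop U) (hf : ∀ j, DifferentiableOn ℂ (f j) U)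
    (hU : IsOpen U) (k : ℕ) :
    TendstoLocallyUniformlyOn (fun j => iteratedDeriv k (f j)) (iteratedDeriv k g) atTop U := by
  induction k with
  | zero => simpa using h
  | succ k ih =>
    simp only [iteratedDeriv_succ]
    exact ih.deriv (Eventually.of_forall fun j => (hf j).iteratedDeriv_of_isOpen hU k) hU

namespace Hol

theorem differentiableOn {Ω : Set ℂ} (F : Hol Ω) : DifferentiableOn ℂ (extendZero (F : Ω → ℂ)) Ω :=
  F.2

/-- The restriction to `Ω` of a function on the plane that is holomorphic on `Ω`. -/
noncomputable def ofDifferentiableOn {Ω : Set ℂ} (g : ℂ → ℂ) (hg : DifferentiableOn ℂ g Ω) :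
    Hol Ω :=
  ⟨fun z => g z, hg.congr fun z hz => extendZero_apply (fun z : Ω => g z) ⟨z, hz⟩⟩

theorem extendZero_of_mem {Ω : Set ℂ} (F : Hol Ω) {z : ℂ} (hz : z ∈ Ω) :
    extendZero (F : Ω → ℂ) z = (F : Ω → ℂ) ⟨z, hz⟩ :=
  extendZero_apply (F : Ω → ℂ) ⟨z, hz⟩

/-- The `k`-th derivative of a holomorphic function on the disk. -/
noncomputable def der (k : ℕ) (F : Hol unitDisk) : ℂ → ℂ :=
  iteratedDeriv k (extendZero (F : unitDisk → ℂ))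

theorem differentiableOn_der (k : ℕ) (F : Hol unitDisk) :
    DifferentiableOn ℂ (der k F) unitDisk :=
  (Hol.differentiableOn F).iteratedDeriv_of_isOpen isOpen_ball k

theorem der_zero_of_mem (F : Hol unitDisk) {z : ℂ} (hz : z ∈ unitDisk) :
    der 0 F z = (F : unitDisk → ℂ) ⟨z, hz⟩ := by
  rw [der, iteratedDeriv_zero, Hol.extendZero_of_mem F hz]

theorem der_eqOn {F : Hol unitDisk} {g : ℂ → ℂ}
    (h : ∀ z (hz : z ∈ unitDisk), (F : unitDisk → ℂ) ⟨z, hz⟩ = g z) (k : ℕ) :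
    EqOn (der k F) (iteratedDeriv k g) unitDisk :=
  EqOn.iteratedDeriv_of_isOpen (fun z hz => (Hol.extendZero_of_mem F hz).trans (h z hz)) isOpen_ball k

theorem contDiffAt_extendZero (F : Hol unitDisk) (k : ℕ) {z : ℂ} (hz : z ∈ unitDisk) :
    ContDiffAt ℂ k (extendZero (F : unitDisk → ℂ)) z :=
  ((Hol.differentiableOn F).analyticAt (isOpen_ball.mem_nhds hz)).contDiffAt

theorem der_add (k : ℕ) (F G : Hol unitDisk) :
    EqOn (der k (F + G)) (der k F + der k G) unitDisk := fun z hz => by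
  rw [der_eqOn (g := extendZero (F : unitDisk → ℂ) + extendZero (G : unitDisk → ℂ)) _ k hz]
  · exact iteratedDeriv_add (contDiffAt_extendZero F k hz) (contDiffAt_extendZero G k hz)
  · intro z hz
    simp [extendZero_of_mem, hz]

theorem der_smul (k : ℕ) (c : ℂ) (F : Hol unitDisk) :
    EqOn (der k (c • F)) (c • der k F) unitDisk := fun z hz => by
  rw [der_eqOn (g := c • extendZero (F : unitDisk → ℂ)) _ k hz]
  · exact iteratedDeriv_const_smul_field c _
  · intro z hz
    simp [extendZero_of_mem, hz]

theorem der_sub (k : ℕ) (F G : Hol unitDisk) :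
    EqOn (der k (F - G)) (der k F - der k G) unitDisk := fun z hz => by
  rw [sub_eq_add_neg, ← neg_one_smul ℂ G, der_add k _ _ hz, Pi.add_apply, der_smul k _ _ hz]
  simp [sub_eq_add_neg]

theorem ext_of_der_zero {F G : Hol unitDisk} (h : ∀ z ∈ unitDisk, der 0 F z = der 0 G z) :
    F = G :=
  Subtype.ext <| funext fun z => by
    simpa only [der_zero_of_mem _ z.2] using h z z.2

end Hol

/-! ### Regular weights and bounds on point evaluations -/

/-- The weighted area measure `v dA`. -/
noncomputable def weightMeasure (v : ℂ → ℝ) : Measure ℂ :=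
  areaMeasure.withDensity fun z => ENNReal.ofReal (v z)

theorem areaMeasure_absolutelyContinuous : areaMeasure ≪ volume.restrict unitDisk :=
  Measure.smul_absolutelyContinuous

theorem weightMeasure_absolutelyContinuous (v : ℂ → ℝ) :
    weightMeasure v ≪ volume.restrict unitDisk :=
  (withDensity_absolutelyContinuous _ _).trans areaMeasure_absolutelyContinuous

theorem ae_areaMeasure_of_forall {p : ℂ → Prop} (h : ∀ z ∈ unitDisk, p z) :
    ∀ᵐ z ∂areaMeasure, p z :=
  areaMeasure_absolutelyContinuous.ae_le <| (ae_restrict_mem measurableSet_ball).mono h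

theorem ae_weightMeasure_of_forall {v : ℂ → ℝ} {p : ℂ → Prop} (h : ∀ z ∈ unitDisk, p z) :
    ∀ᵐ z ∂weightMeasure v, p z :=
  (withDensity_absolutelyContinuous _ _).ae_le (ae_areaMeasure_of_forall h)

instance : IsFiniteMeasure areaMeasure where
  measure_univ_lt_top := by
    rw [areaMeasure, Measure.smul_apply, Measure.restrict_apply_univ, smul_eq_mul]
    exact ENNReal.mul_lt_top ENNReal.ofReal_lt_top measure_ball_lt_top

theorem Hol.aestronglyMeasurable_der (k : ℕ) (F : Hol unitDisk) :
    AEStronglyMeasurable (der k F) (volume.restrict unitDisk) :=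
  (Hol.differentiableOn_der k F).continuousOn.aestronglyMeasurable measurableSet_ball

/-- The properties of an admissible weight that the theory of `ℋ_{v,n}` uses, stated pointwise. -/
structure IsRegularWeight (v : ℂ → ℝ) : Prop where
  measurable : Measurable v
  pos : ∀ z, 0 < v z
  le_one : ∀ z ∈ unitDisk, v z ≤ 1
  lower_bound : ∀ r : ℝ, 0 < r → r < 1 → ∃ δ : ℝ, 0 < δ ∧ ∀ z, ‖z‖ < r → δ < v z
  le_dilation : ∀ r : ℝ, 0 < r → r < 1 → ∀ z ∈ unitDisk, v z ≤ v ((r : ℂ) * z)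

namespace IsRegularWeight

variable {v : ℂ → ℝ}

theorem isAdmissibleWeight (hv : IsRegularWeight v) : IsAdmissibleWeight v where
  integrable := by
    refine Integrable.of_bound hv.measurable.aestronglyMeasurable 1
      (ae_areaMeasure_of_forall fun z hz => ?_)
    rw [Real.norm_of_nonneg (hv.pos z).le]
    exact hv.le_one z hz
  lower_bound r h0 h1 := by
    obtain ⟨δ, hδ, h⟩ := hv.lower_bound r h0 h1
    exact ⟨δ, hδ, Eventually.of_forall h⟩
  le_dilation r h0 h1 := ae_areaMeasure_of_forall (hv.le_dilation r h0 h1)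

theorem lintegral_weightMeasure (hv : IsRegularWeight v) {f : ℂ → ℝ≥0∞}
    (hf : AEMeasurable f (volume.restrict unitDisk)) :
    ∫⁻ z, f z ∂weightMeasure v = ∫⁻ z, f z * ENNReal.ofReal (v z) ∂areaMeasure := by
  rw [weightMeasure, lintegral_withDensity_eq_lintegral_mul₀
    hv.measurable.ennreal_ofReal.aemeasurable (hf.mono_ac areaMeasure_absolutelyContinuous)]
  simp only [Pi.mul_apply, mul_comm]

theorem weightedNormSq_eq (hv : IsRegularWeight v) (n : ℕ) (F : Hol unitDisk) :
    weightedNormSq v n F =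
      ∑ k ∈ Finset.range (n + 1), ∫⁻ z, ‖Hol.der k F z‖ₑ ^ 2 ∂weightMeasure v :=
  Finset.sum_congr rfl fun k _ =>
    (hv.lintegral_weightMeasure ((Hol.aestronglyMeasurable_der k F).enorm.pow_const 2)).symm

end IsRegularWeight

/-- Point evaluation of the derivatives is controlled by the weighted norm on a disk where the
weight is bounded below. -/
theorem sq_enorm_der_le (v : ℂ → ℝ) {n k : ℕ} (hk : k ≤ n) (F : Hol unitDisk) {z : ℂ} {ρ c : ℝ}
    (hρ : 0 < ρ) (hc : 0 < c) (hball : ball z ρ ⊆ unitDisk) (hv : ∀ ζ ∈ ball z ρ, c ≤ v ζ) :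
    ENNReal.ofReal (c * ρ ^ 2) * ‖Hol.der k F z‖ₑ ^ 2 ≤ weightedNormSq v n F := by
  calc ENNReal.ofReal (c * ρ ^ 2) * ‖Hol.der k F z‖ₑ ^ 2
      = ENNReal.ofReal Real.pi⁻¹ * (ENNReal.ofReal c *
          (ENNReal.ofReal (Real.pi * ρ ^ 2) * ‖Hol.der k F z‖ₑ ^ 2)) := by
        rw [← mul_assoc, ← mul_assoc, ← ENNReal.ofReal_mul (by positivity),
          ← ENNReal.ofReal_mul (by positivity)]
        congr 2
        field_simp
    _ ≤ ENNReal.ofReal Real.pi⁻¹ * (ENNReal.ofReal c * ∫⁻ ζ in ball z ρ, ‖Hol.der k F ζ‖ₑ ^ 2) := by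
        gcongr
        exact sq_enorm_le_lintegral_ball hρ ((Hol.differentiableOn_der k F).mono hball)
    _ ≤ ENNReal.ofReal Real.pi⁻¹ *
          ∫⁻ ζ in ball z ρ, ‖Hol.der k F ζ‖ₑ ^ 2 * ENNReal.ofReal (v ζ) := by
        gcongr
        rw [← lintegral_const_mul' _ _ ENNReal.ofReal_ne_top]
        refine setLIntegral_mono' measurableSet_ball fun ζ hζ => ?_
        rw [mul_comm]
        gcongr
        exact hv ζ hζ
    _ ≤ ∫⁻ ζ, ‖Hol.der k F ζ‖ₑ ^ 2 * ENNReal.ofReal (v ζ) ∂areaMeasure := by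
        rw [areaMeasure, lintegral_smul_measure, smul_eq_mul]
        gcongr
    _ ≤ _ := Finset.single_le_sum
        (f := fun k => ∫⁻ ζ, ‖Hol.der k F ζ‖ₑ ^ 2 * ENNReal.ofReal (v ζ) ∂areaMeasure)
        (fun _ _ => zero_le) (Finset.mem_range.2 (Nat.lt_succ_of_le hk))

/-- Point evaluations of the derivatives are bounded, uniformly on smaller disks. -/
theorem IsRegularWeight.exists_sq_enorm_der_le {v : ℂ → ℝ} (hv : IsRegularWeight v) (n : ℕ) {r : ℝ}
    (hr0 : 0 < r) (hr : r < 1) : ∃ C : ℝ≥0∞, C ≠ ∞ ∧ ∀ (F : Hol unitDisk), ∀ k ≤ n, ∀ z : ℂ,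
      ‖z‖ ≤ r → ‖Hol.der k F z‖ₑ ^ 2 ≤ C * weightedNormSq v n F := by
  -- Disks of radius (1 - r)/2 centred in |z| ≤ r stay inside |ζ| < (1 + r)/2.
  obtain ⟨δ, hδ, h⟩ := hv.lower_bound ((1 + r) / 2) (by linarith) (by linarith)
  have hρ : 0 < (1 - r) / 2 := by linarith
  have hpos : ENNReal.ofReal (δ * ((1 - r) / 2) ^ 2) ≠ 0 := by
    rw [Ne, ENNReal.ofReal_eq_zero, not_le]; positivity
  refine ⟨(ENNReal.ofReal (δ * ((1 - r) / 2) ^ 2))⁻¹, ENNReal.inv_ne_top.2 hpos,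
    fun F k hk z hz => ?_⟩
  have hb : ∀ ζ ∈ ball z ((1 - r) / 2), ‖ζ‖ < (1 + r) / 2 := fun ζ hζ => by
    have h1 := norm_le_norm_add_norm_sub' ζ z
    rw [mem_ball, dist_eq_norm] at hζ
    linarith
  rw [mul_comm, ← div_eq_mul_inv, ENNReal.le_div_iff_mul_le (.inl hpos) (.inl ENNReal.ofReal_ne_top),
    mul_comm]
  refine sq_enorm_der_le v hk F hρ hδ (fun ζ hζ => ?_) fun ζ hζ => (h ζ (hb ζ hζ)).le
  rw [mem_ball_zero_iff]
  linarith [hb ζ hζ]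

/-! ### Completeness of the weighted space, through jets in L² -/

theorem ofReal_norm_toLp_sq {μ : Measure ℂ} {f : ℂ → ℂ} (hf : MemLp f 2 μ) :
    ENNReal.ofReal (‖hf.toLp f‖ ^ 2) = ∫⁻ z, ‖f z‖ₑ ^ 2 ∂μ := by
  rw [Lp.norm_toLp, ENNReal.ofReal_pow ENNReal.toReal_nonneg, ENNReal.ofReal_toReal hf.2.ne]
  have h := eLpNorm_nnreal_pow_eq_lintegral (μ := μ) (f := f) (p := 2) two_ne_zero
  simpa using h

theorem ENNReal.ofReal_norm_sq {E : Type*} [SeminormedAddCommGroup E] (x : E) :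
    ENNReal.ofReal (‖x‖ ^ 2) = ‖x‖ₑ ^ 2 := by
  rw [ENNReal.ofReal_pow (norm_nonneg _), ofReal_norm]

namespace IsRegularWeight

variable {v : ℂ → ℝ}

theorem memLp_der_iff (k : ℕ) (F : Hol unitDisk) :
    MemLp (Hol.der k F) 2 (weightMeasure v) ↔
      ∫⁻ z, ‖Hol.der k F z‖ₑ ^ 2 ∂weightMeasure v < ∞ := by
  have h := eLpNorm_nnreal_pow_eq_lintegral (μ := weightMeasure v) (f := Hol.der k F) (p := 2)
    two_ne_zero
  have h' : eLpNorm (Hol.der k F) 2 (weightMeasure v) ^ 2 =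
      ∫⁻ z, ‖Hol.der k F z‖ₑ ^ 2 ∂weightMeasure v := by simpa using h
  rw [← h', ENNReal.pow_lt_top_iff, MemLp]
  simp [(Hol.aestronglyMeasurable_der k F).mono_ac (weightMeasure_absolutelyContinuous v)]

theorem weightedNormSq_lt_top_iff (hv : IsRegularWeight v) (n : ℕ) (F : Hol unitDisk) :
    weightedNormSq v n F < ∞ ↔ ∀ k : Fin (n + 1), MemLp (Hol.der k F) 2 (weightMeasure v) := by
  rw [hv.weightedNormSq_eq, ENNReal.sum_lt_top]
  simp only [Finset.mem_range, ← memLp_der_iff]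
  exact ⟨fun h k => h k k.2, fun h k hk => h ⟨k, hk⟩⟩

theorem der_add_ae (k : ℕ) (F G : Hol unitDisk) :
    Hol.der k (F + G) =ᵐ[weightMeasure v] Hol.der k F + Hol.der k G :=
  ae_weightMeasure_of_forall fun _ hz => Hol.der_add k F G hz

theorem der_smul_ae (k : ℕ) (c : ℂ) (F : Hol unitDisk) :
    Hol.der k (c • F) =ᵐ[weightMeasure v] c • Hol.der k F :=
  ae_weightMeasure_of_forall fun _ hz => Hol.der_smul k c F hz

/-- The space `ℋ_{v,n}`, as a submodule of `Hol(𝔻)`. -/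
noncomputable def weightedSubmodule (v : ℂ → ℝ) (n : ℕ) : Submodule ℂ (Hol unitDisk) where
  carrier := {F | ∀ k : Fin (n + 1), MemLp (Hol.der k F) 2 (weightMeasure v)}
  add_mem' {F G} hF hG k := ((hF k).add (hG k)).ae_eq (der_add_ae k F G).symm
  zero_mem' k := by
    refine (memLp_congr_ae ?_).2 (MemLp.zero (ε := ℂ))
    simpa using der_smul_ae (v := v) k 0 0
  smul_mem' c F hF k := ((hF k).const_smul c).ae_eq (der_smul_ae k c F).symm

/-- The embedding `F ↦ (F, F', …, F⁽ⁿ⁾)` of `ℋ_{v,n}` into a sum of `L²` spaces. -/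
noncomputable def jet (v : ℂ → ℝ) (n : ℕ) : weightedSubmodule v n →ₗ[ℂ]
    PiLp 2 (fun _ : Fin (n + 1) => Lp ℂ 2 (weightMeasure v)) where
  toFun F := WithLp.toLp 2 fun k => (F.2 k).toLp
  map_add' F G := by
    ext1 k
    simp only [PiLp.add_apply]
    rw [← MemLp.toLp_add]
    exact MemLp.toLp_congr _ _ (der_add_ae k (F : Hol unitDisk) G)
  map_smul' c F := by
    ext1 k
    simp only [PiLp.smul_apply, RingHom.id_apply]
    rw [← MemLp.toLp_const_smul]
    exact MemLp.toLp_congr _ _ (der_smul_ae k c (F : Hol unitDisk))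

theorem enorm_jet_sq (hv : IsRegularWeight v) (n : ℕ) (F : weightedSubmodule v n) :
    ‖jet v n F‖ₑ ^ 2 = weightedNormSq v n F := by
  rw [← ENNReal.ofReal_norm_sq, PiLp.norm_sq_eq_of_L2, hv.weightedNormSq_eq,
    ENNReal.ofReal_sum_of_nonneg (fun _ _ => by positivity), Finset.sum_range]
  exact Finset.sum_congr rfl fun k _ => ofReal_norm_toLp_sq (F.2 k)

theorem eq_zero_of_weightedNormSq_eq_zero (hv : IsRegularWeight v) {n : ℕ} {F : Hol unitDisk}
    (hF : weightedNormSq v n F = 0) : F = 0 := by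
  refine Hol.ext_of_der_zero fun z hz => ?_
  have hz' : ‖z‖ < 1 := by simpa using hz
  obtain ⟨C, -, h⟩ := hv.exists_sq_enorm_der_le n (r := (1 + ‖z‖) / 2)
    (by positivity) (by linarith)
  have h0 := h F 0 (Nat.zero_le n) z (by linarith)
  rw [Hol.der_zero_of_mem 0 hz]
  simpa [hF] using h0

theorem injective_jet (hv : IsRegularWeight v) (n : ℕ) : Function.Injective (jet v n) := by
  intro F G h
  have h0 : weightedNormSq v n ((F : Hol unitDisk) - G) = 0 := by
    have h1 := hv.enorm_jet_sq n (F - G)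
    rw [(jet v n).map_sub F G, h, sub_self] at h1
    rw [← Submodule.coe_sub, ← h1]
    simp
  exact Subtype.ext (sub_eq_zero.1 (hv.eq_zero_of_weightedNormSq_eq_zero h0))

theorem exists_norm_der_sub_le (hv : IsRegularWeight v) (n : ℕ) {r : ℝ} (hr0 : 0 < r)
    (hr : r < 1) : ∃ C : ℝ, 0 < C ∧ ∀ (F G : weightedSubmodule v n), ∀ k ≤ n, ∀ z : ℂ, ‖z‖ ≤ r →
      ‖Hol.der k F z - Hol.der k G z‖ ≤ C * ‖jet v n F - jet v n G‖ := by
  obtain ⟨C, hC, h⟩ := hv.exists_sq_enorm_der_le n hr0 hr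
  -- The added 1 only makes the constant positive, so that one can divide by it.
  refine ⟨√C.toReal + 1, by positivity, fun F G k hk z hz => ?_⟩
  have hz' : z ∈ unitDisk := by simpa using hz.trans_lt hr
  have h1 := h (F - G : weightedSubmodule v n) k hk z hz
  rw [← hv.enorm_jet_sq, (jet v n).map_sub F G, Submodule.coe_sub, Hol.der_sub k _ _ hz', Pi.sub_apply,
    ← ENNReal.ofReal_norm_sq, ← ENNReal.ofReal_norm_sq, ← ENNReal.ofReal_toReal hC,
    ← ENNReal.ofReal_mul ENNReal.toReal_nonneg, ENNReal.ofReal_le_ofReal_iff (by positivity)] at h1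
  have h2 : ‖Hol.der k F z - Hol.der k G z‖ ≤ √C.toReal * ‖jet v n F - jet v n G‖ := by
    refine (abs_le_of_sq_le_sq' ?_ (by positivity)).2
    rwa [mul_pow, Real.sq_sqrt ENNReal.toReal_nonneg]
  nlinarith [norm_nonneg (jet v n F - jet v n G)]

/-- Norm convergence of the jets forces the functions to be uniformly Cauchy on compact sets. By
Weierstrass the limit is holomorphic and all derivatives converge pointwise, which identifies the L²
limits with the derivatives of one holomorphic function. -/
theorem isClosed_range_jet (hv : IsRegularWeight v) (n : ℕ) :
    IsClosed ((jet v n).range : Set (PiLp 2 fun _ : Fin (n + 1) => Lp ℂ 2 (weightMeasure v))) := by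
  refine IsSeqClosed.isClosed fun u g hu hg => ?_
  choose F hF using hu
  obtain rfl : (fun j => jet v n (F j)) = u := funext hF
  have hcau := hg.cauchySeq
  have huc : ∀ r : ℝ, 0 < r → r < 1 → UniformCauchySeqOn
      (fun j => extendZero ((F j : Hol unitDisk) : unitDisk → ℂ)) atTop (closedBall 0 r) := by
    intro r hr0 hr
    obtain ⟨C, hC, h⟩ := hv.exists_norm_der_sub_le n hr0 hr
    rw [Metric.uniformCauchySeqOn_iff]
    intro ε hε
    obtain ⟨N, hN⟩ := Metric.cauchySeq_iff.1 hcau (ε / C) (by positivity)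
    refine ⟨N, fun i hi j hj z hz => ?_⟩
    have h1 := h (F i) (F j) 0 (Nat.zero_le n) z (by simpa using hz)
    have h2 := hN i hi j hj
    rw [dist_eq_norm, lt_div_iff₀ hC] at h2
    simp only [Hol.der, iteratedDeriv_zero] at h1
    rw [dist_eq_norm]
    linarith
  have hlim : ∀ z : ℂ, ∃ l : ℂ, z ∈ unitDisk →
      Tendsto (fun j => extendZero ((F j : Hol unitDisk) : unitDisk → ℂ) z) atTop (𝓝 l) := by
    intro z
    by_cases hz : z ∈ unitDisk
    · have hz' : ‖z‖ < 1 := by simpa using hz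
      have hc := (huc ((1 + ‖z‖) / 2) (by positivity) (by linarith)).cauchy_map
        (x := z) (by rw [mem_closedBall_zero_iff]; linarith)
      obtain ⟨l, hl⟩ := cauchy_iff_exists_le_nhds.1 hc
      exact ⟨l, fun _ => hl⟩
    · exact ⟨0, fun h => absurd h hz⟩
  choose f hf using hlim
  have hloc : TendstoLocallyUniformlyOn
      (fun j => extendZero ((F j : Hol unitDisk) : unitDisk → ℂ)) f atTop unitDisk := by
    rw [tendstoLocallyUniformlyOn_iff_forall_isCompact isOpen_ball]
    intro K hK hKc
    obtain ⟨r, ⟨hr0, hr⟩, hKr⟩ : ∃ r ∈ Ioo (0 : ℝ) 1, K ⊆ ball 0 r := by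
      obtain ⟨r, hr, h⟩ := exists_pos_lt_subset_ball one_pos hKc.isClosed hK
      exact ⟨r, hr, h⟩
    have hKr' : K ⊆ closedBall 0 r := hKr.trans ball_subset_closedBall
    exact ((huc r hr0 hr).tendstoUniformlyOn_of_tendsto fun z hz =>
      hf z (by rw [mem_closedBall_zero_iff] at hz; simpa using hz.trans_lt hr)).mono hKr'
  have hdiff : ∀ j, DifferentiableOn ℂ (extendZero ((F j : Hol unitDisk) : unitDisk → ℂ)) unitDisk :=
    fun j => Hol.differentiableOn (F j : Hol unitDisk)
  have hfd : DifferentiableOn ℂ f unitDisk :=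
    hloc.differentiableOn (Eventually.of_forall hdiff) isOpen_ball
  set G : Hol unitDisk := Hol.ofDifferentiableOn f hfd with hG
  have hder : ∀ k, ∀ z ∈ unitDisk,
      Tendsto (fun j => Hol.der k (F j) z) atTop (𝓝 (Hol.der k G z)) := by
    intro k z hz
    rw [Hol.der_eqOn (F := G) (g := f) (fun _ _ => rfl) k hz]
    exact (hloc.iteratedDeriv hdiff isOpen_ball k).tendsto_at hz
  -- A subsequence of an L² convergent sequence converges almost everywhere, so the two limits
  -- agree.
  have hae : ∀ k : Fin (n + 1), g k =ᵐ[weightMeasure v] Hol.der k G := by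
    intro k
    have h1 : Tendsto (fun j => jet v n (F j) k) atTop (𝓝 (g k)) :=
      ((PiLp.continuous_apply 2 _ k).tendsto g).comp hg
    obtain ⟨ns, hns, h2⟩ := (tendstoInMeasure_of_tendsto_Lp h1).exists_seq_tendsto_ae
    have h3 : ∀ᵐ z ∂weightMeasure v, ∀ j, jet v n (F j) k z = Hol.der k (F j) z :=
      ae_all_iff.2 fun j => MemLp.coeFn_toLp ((F j).2 k)
    have h4 : ∀ᵐ z ∂weightMeasure v, z ∈ unitDisk := ae_weightMeasure_of_forall fun _ h => h
    filter_upwards [h2, h3, h4] with z h2 h3 h4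
    simp only [h3] at h2
    exact tendsto_nhds_unique h2 ((hder k z h4).comp hns.tendsto_atTop)
  have hmem : ∀ k : Fin (n + 1), MemLp (Hol.der k G) 2 (weightMeasure v) :=
    fun k => (memLp_congr_ae (hae k)).1 (Lp.memLp _)
  refine ⟨⟨G, hmem⟩, ?_⟩
  ext1 k
  exact Lp.ext ((MemLp.coeFn_toLp (hmem k)).trans (hae k).symm)

/-- `ℋ_{v,n}` is a Hilbert space. -/
theorem exists_isWeightedSpace (hv : IsRegularWeight v) (n : ℕ) :
    ∃ (H : Type) (_ : NormedAddCommGroup H) (_ : InnerProductSpace ℂ H) (_ : CompleteSpace H)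
      (ι : H →ₗ[ℂ] Hol unitDisk), Function.Injective ι ∧ IsWeightedSpace ι v n := by
  have hc : CompleteSpace (jet v n).range := (hv.isClosed_range_jet n).completeSpace_coe
  let e := LinearEquiv.ofInjective (jet v n) (hv.injective_jet n)
  -- The Hilbert space is the range of `jet`, with the inner product of the L² sum; ι recovers F
  -- from its jet.
  refine ⟨(jet v n).range, inferInstance, inferInstance, hc,
    (weightedSubmodule v n).subtype ∘ₗ (e.symm : (jet v n).range →ₗ[ℂ] weightedSubmodule v n),
    Subtype.val_injective.comp e.symm.injective, ?_, fun F => ?_⟩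
  · ext F
    rw [mem_ofPred_eq, hv.weightedNormSq_lt_top_iff]
    constructor
    · rintro ⟨x, rfl⟩
      exact (e.symm x).2
    · exact fun h => ⟨e ⟨F, h⟩, by simp⟩
  · obtain ⟨G, rfl⟩ := e.surjective F
    rw [ENNReal.ofReal_norm_sq]
    have h : ‖e G‖ₑ = ‖jet v n G‖ₑ := rfl
    rw [h, hv.enorm_jet_sq]
    simp

end IsRegularWeight

/-! ### Polynomials and Taylor approximation in the space -/

/-- Taylor polynomials converge locally uniformly. -/
theorem exists_polynomial_tendstoLocallyUniformlyOn {G : ℂ → ℂ} {R : ℝ} (hR : 0 < R)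
    (hG : DifferentiableOn ℂ G (closedBall 0 R)) :
    ∃ p : ℕ → Polynomial ℂ,
      TendstoLocallyUniformlyOn (fun N z => (p N).eval z) G atTop (ball 0 R) := by
  lift R to NNReal using hR.le
  have h := (hG.hasFPowerSeriesOnBall hR).tendstoLocallyUniformlyOn'
  rw [Metric.eball_coe] at h
  refine ⟨fun N => ∑ k ∈ Finset.range N,
    Polynomial.monomial k ((cauchyPowerSeries G 0 R).coeff k), h.congr fun N z _ => ?_⟩
  simp [FormalMultilinearSeries.partialSum, Polynomial.eval_finsetSum, mul_comm]

/-- `polyHol` as a linear map. -/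
noncomputable def polyHolₗ (Ω : Set ℂ) : Polynomial ℂ →ₗ[ℂ] Hol Ω where
  toFun := polyHol Ω
  map_add' p q := Subtype.ext <| funext fun z => by simp [polyHol]
  map_smul' c p := Subtype.ext <| funext fun z => by simp [polyHol]

theorem der_polyHol (k : ℕ) (p : Polynomial ℂ) :
    EqOn (Hol.der k (polyHol unitDisk p)) (iteratedDeriv k fun z => p.eval z) unitDisk :=
  Hol.der_eqOn (fun _ _ => rfl) k

theorem exists_bound_on_unitDisk {G : ℂ → ℂ} {R : ℝ} (hR : 1 < R)
    (hG : DifferentiableOn ℂ G (ball 0 R)) : ∃ M : ℝ, ∀ z ∈ unitDisk, ‖G z‖ ≤ M := by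
  obtain ⟨M, hM⟩ := (isCompact_closedBall (0 : ℂ) 1).exists_bound_of_continuousOn
    (hG.continuousOn.mono (closedBall_subset_ball hR))
  exact ⟨M, fun z hz => hM z (ball_subset_closedBall hz)⟩

theorem weightedNormSq_le {v : ℂ → ℝ} {n : ℕ} {F : Hol unitDisk} {M : ℝ}
    (h : ∀ k ≤ n, ∀ z ∈ unitDisk, ‖Hol.der k F z‖ ^ 2 * v z ≤ M) :
    weightedNormSq v n F ≤ (n + 1 : ℕ) * (ENNReal.ofReal M * areaMeasure univ) := by
  refine (Finset.sum_le_card_nsmul (Finset.range (n + 1)) _ (ENNReal.ofReal M * areaMeasure univ)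
    fun k hk => ?_).trans_eq (by rw [Finset.card_range, nsmul_eq_mul])
  rw [← lintegral_const]
  refine lintegral_mono_ae (ae_areaMeasure_of_forall fun z hz => ?_)
  rw [← ENNReal.ofReal_norm_sq, ← ENNReal.ofReal_mul (by positivity)]
  exact ENNReal.ofReal_le_ofReal (h k (Nat.lt_succ_iff.1 (Finset.mem_range.1 hk)) z hz)

/-- Each derivative of G is bounded on the closed unit disk by compactness, and v ≤ 1 on a finite
measure space. -/
theorem IsRegularWeight.weightedNormSq_lt_top {v : ℂ → ℝ} (hv : IsRegularWeight v) (n : ℕ) {G : ℂ → ℂ}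
    {F : Hol unitDisk} (hF : ∀ z (hz : z ∈ unitDisk), (F : unitDisk → ℂ) ⟨z, hz⟩ = G z) {R : ℝ}
    (hR : 1 < R) (hG : DifferentiableOn ℂ G (ball 0 R)) : weightedNormSq v n F < ∞ := by
  have hb : ∀ k, ∃ M : ℝ, ∀ z ∈ unitDisk, ‖iteratedDeriv k G z‖ ≤ M := fun k =>
    exists_bound_on_unitDisk hR (hG.iteratedDeriv_of_isOpen isOpen_ball k)
  choose M hM using hb
  refine (weightedNormSq_le (M := ∑ k ∈ Finset.range (n + 1), M k ^ 2) fun k hk z hz => ?_).trans_lt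
    (ENNReal.mul_lt_top (by simp) (ENNReal.mul_lt_top (by simp) (measure_lt_top _ _)))
  rw [Hol.der_eqOn hF k hz]
  calc ‖iteratedDeriv k G z‖ ^ 2 * v z ≤ M k ^ 2 * 1 := by
        gcongr
        exacts [(hv.pos z).le, hM k z hz, hv.le_one z hz]
    _ ≤ _ := by
        rw [mul_one]
        exact Finset.single_le_sum (f := fun k => M k ^ 2) (fun _ _ => sq_nonneg _)
          (Finset.mem_range.2 (Nat.lt_succ_of_le hk))

namespace IsWeightedSpace

variable {H : Type*} [NormedAddCommGroup H] [InnerProductSpace ℂ H] {ι : H →ₗ[ℂ] Hol unitDisk}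
  {v : ℂ → ℝ} {n : ℕ}

theorem enorm_sq (h : IsWeightedSpace ι v n) (x : H) : ‖x‖ₑ ^ 2 = weightedNormSq v n (ι x) := by
  rw [← h.2, ENNReal.ofReal_norm_sq]

theorem exists_eq (h : IsWeightedSpace ι v n) {F : Hol unitDisk} (hF : weightedNormSq v n F < ∞) :
    ∃ x, ι x = F := by
  have : F ∈ range ι := h.1 ▸ hF
  exact this

theorem norm_sq_le (h : IsWeightedSpace ι v n) {x : H} {M : ℝ} (hM : 0 ≤ M)
    (hb : ∀ k ≤ n, ∀ z ∈ unitDisk, ‖Hol.der k (ι x) z‖ ^ 2 * v z ≤ M) :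
    ‖x‖ ^ 2 ≤ (n + 1) * areaMeasure.real univ * M := by
  have h1 := weightedNormSq_le hb
  rw [← h.2] at h1
  have h2 : ((n + 1 : ℕ) : ℝ≥0∞) * (ENNReal.ofReal M * areaMeasure univ) =
      ENNReal.ofReal ((n + 1) * areaMeasure.real univ * M) := by
    rw [ENNReal.ofReal_mul (by positivity), ENNReal.ofReal_mul (by positivity), Measure.real,
      ENNReal.ofReal_toReal (measure_ne_top _ _), mul_comm (ENNReal.ofReal M), mul_assoc]
    congr 1
    rw [← ENNReal.ofReal_natCast]
    push_cast
    rfl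
  rwa [h2, ENNReal.ofReal_le_ofReal_iff (by positivity)] at h1

theorem norm_der_le (h : IsWeightedSpace ι v n) {k : ℕ} (hk : k ≤ n) (x : H) {z : ℂ} {ρ c : ℝ}
    (hρ : 0 < ρ) (hc : 0 < c) (hball : ball z ρ ⊆ unitDisk) (hv : ∀ ζ ∈ ball z ρ, c ≤ v ζ) :
    ‖Hol.der k (ι x) z‖ ≤ (√c * ρ)⁻¹ * ‖x‖ := by
  have h1 := sq_enorm_der_le v hk (ι x) hρ hc hball hv
  rw [← h.2, ← ENNReal.ofReal_norm_sq, ← ENNReal.ofReal_mul (by positivity),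
    ENNReal.ofReal_le_ofReal_iff (by positivity)] at h1
  rw [inv_mul_eq_div, le_div_iff₀ (by positivity)]
  refine (abs_le_of_sq_le_sq' ?_ (norm_nonneg x)).2
  rw [mul_pow, mul_pow, Real.sq_sqrt hc.le]
  linarith

/-- Evaluation at a point of the disk, as a continuous linear functional. -/
theorem exists_eval (h : IsWeightedSpace ι v n) (hv : IsRegularWeight v) {w : ℂ}
    (hw : w ∈ unitDisk) : ∃ Λ : H →L[ℂ] ℂ, ∀ x, Λ x = (ι x : unitDisk → ℂ) ⟨w, hw⟩ := by
  have hw' : ‖w‖ < 1 := by simpa using hw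
  have hρ : 0 < (1 - ‖w‖) / 2 := by linarith
  have hb : ∀ ζ ∈ ball w ((1 - ‖w‖) / 2), ‖ζ‖ < (1 + ‖w‖) / 2 := fun ζ hζ => by
    have h1 := norm_le_norm_add_norm_sub' ζ w
    rw [mem_ball, dist_eq_norm] at hζ
    linarith
  obtain ⟨δ, hδ, hlow⟩ := hv.lower_bound ((1 + ‖w‖) / 2) (by positivity) (by linarith)
  let L : H →ₗ[ℂ] ℂ :=
    { toFun := fun x => (ι x : unitDisk → ℂ) ⟨w, hw⟩
      map_add' := fun x y => by simp
      map_smul' := fun c x => by simp }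
  refine ⟨L.mkContinuous (√δ * ((1 - ‖w‖) / 2))⁻¹ fun x => ?_, fun x => rfl⟩
  have h1 := h.norm_der_le (Nat.zero_le n) x hρ hδ
    (fun ζ hζ => by rw [mem_ball_zero_iff]; linarith [hb ζ hζ]) fun ζ hζ => (hlow ζ (hb ζ hζ)).le
  rwa [Hol.der_zero_of_mem _ hw] at h1

theorem evaluationsContinuous (h : IsWeightedSpace ι v n) (hv : IsRegularWeight v) :
    EvaluationsContinuous ι := fun w => by
  obtain ⟨Λ, hΛ⟩ := h.exists_eval hv w.2
  exact Λ.continuous.congr hΛ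

/-- The polynomials in the space. -/
theorem exists_poly (h : IsWeightedSpace ι v n) (hv : IsRegularWeight v)
    (hι : Function.Injective ι) :
    ∃ pol : Polynomial ℂ →ₗ[ℂ] H, ∀ p, ι (pol p) = polyHol unitDisk p := by
  have hr : ∀ p, polyHolₗ unitDisk p ∈ LinearMap.range ι := fun p =>
    h.exists_eq (hv.weightedNormSq_lt_top n (G := fun z => p.eval z) (R := 2) (fun _ _ => rfl)
      (by norm_num) p.differentiable.differentiableOn)
  refine ⟨(LinearEquiv.ofInjective ι hι).symm.toLinearMap ∘ₗ (polyHolₗ unitDisk).codRestrict _ hr,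
    fun p => ?_⟩
  have := LinearEquiv.apply_symm_apply (LinearEquiv.ofInjective ι hι) ⟨polyHolₗ unitDisk p, hr p⟩
  exact congrArg Subtype.val this

/-- Functions holomorphic on a larger disk are approximated by their Taylor polynomials, in the
space and at all points of the larger disk. -/
theorem exists_polynomial_tendsto (h : IsWeightedSpace ι v n) (hv : IsRegularWeight v)
    {pol : Polynomial ℂ →ₗ[ℂ] H} (hpol : ∀ p, ι (pol p) = polyHol unitDisk p) {G : ℂ → ℂ} {R : ℝ}
    (hR : 1 < R) (hG : DifferentiableOn ℂ G (closedBall 0 R)) {x : H}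
    (hx : ∀ z (hz : z ∈ unitDisk), (ι x : unitDisk → ℂ) ⟨z, hz⟩ = G z) :
    ∃ p : ℕ → Polynomial ℂ, Tendsto (fun N => pol (p N)) atTop (𝓝 x) ∧
      ∀ w ∈ ball (0 : ℂ) R, Tendsto (fun N => (p N).eval w) atTop (𝓝 (G w)) := by
  obtain ⟨p, hp⟩ := exists_polynomial_tendstoLocallyUniformlyOn (by linarith) hG
  refine ⟨p, ?_, fun w hw => hp.tendsto_at hw⟩
  set C : ℝ := (n + 1) * areaMeasure.real univ with hC
  have hC0 : 0 ≤ C := by positivity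
  rw [Metric.tendsto_nhds]
  intro η hη
  -- With this tolerance the squared norm is at most C η² / (C + 1) < η².
  have hε : 0 < η / √(C + 1) := by positivity
  have hu : ∀ k ∈ Finset.range (n + 1), ∀ᶠ N in atTop, ∀ z ∈ closedBall (0 : ℂ) 1,
      dist (iteratedDeriv k G z) (iteratedDeriv k (fun z => (p N).eval z) z) < η / √(C + 1) := by
    intro k _
    have h1 := hp.iteratedDeriv (fun N => (p N).differentiable.differentiableOn) isOpen_ball k
    rw [tendstoLocallyUniformlyOn_iff_forall_isCompact isOpen_ball] at h1
    exact Metric.tendstoUniformlyOn_iff.1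
      (h1 _ (closedBall_subset_ball hR) (isCompact_closedBall 0 1)) _ hε
  filter_upwards [(Filter.eventually_all_finset _).2 hu] with N hN
  have hb := h.norm_sq_le (x := pol (p N) - x) (M := (η / √(C + 1)) ^ 2) (by positivity)
    fun k hk z hz => by
      rw [map_sub, Hol.der_sub k _ _ hz, Pi.sub_apply, hpol, der_polyHol k _ hz,
        Hol.der_eqOn hx k hz, ← dist_eq_norm, dist_comm]
      have h1 := hN k (Finset.mem_range.2 (Nat.lt_succ_of_le hk)) z (ball_subset_closedBall hz)
      calc _ ≤ (η / √(C + 1)) ^ 2 * 1 := by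
            gcongr
            exacts [(hv.pos z).le, hv.le_one z hz]
        _ = _ := mul_one _
  rw [dist_eq_norm]
  refine lt_of_pow_lt_pow_left₀ 2 hη.le (hb.trans_lt ?_)
  rw [← hC, div_pow, Real.sq_sqrt (by positivity), ← mul_div_assoc, div_lt_iff₀ (by positivity)]
  nlinarith [pow_pos hη 2]

theorem mem_closure_poly (h : IsWeightedSpace ι v n) (hv : IsRegularWeight v)
    {pol : Polynomial ℂ →ₗ[ℂ] H} (hpol : ∀ p, ι (pol p) = polyHol unitDisk p) {G : ℂ → ℂ} {R : ℝ}
    (hR : 1 < R) (hG : DifferentiableOn ℂ G (closedBall 0 R)) {x : H}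
    (hx : ∀ z (hz : z ∈ unitDisk), (ι x : unitDisk → ℂ) ⟨z, hz⟩ = G z) :
    x ∈ (LinearMap.range pol).topologicalClosure := by
  obtain ⟨p, hp, -⟩ := h.exists_polynomial_tendsto hv hpol hR hG hx
  exact mem_closure_of_tendsto hp (Eventually.of_forall fun N => ⟨p N, rfl⟩)

end IsWeightedSpace

/-! ### Dilations and density of the polynomials -/

theorem lintegral_comp_ofReal_mul (g : ℂ → ℝ≥0∞) {r : ℝ} (hr : 0 < r) :
    ∫⁻ z, g ((r : ℂ) * z) = ENNReal.ofReal ((r ^ 2)⁻¹) * ∫⁻ z, g z := by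
  have h := (measurableEmbedding_const_smul₀ (α := ℂ) hr.ne').lintegral_map (μ := volume) g
  rw [Measure.map_addHaar_smul _ hr.ne', lintegral_smul_measure, Complex.finrank_real_complex,
    abs_of_pos (by positivity)] at h
  simpa using h.symm

theorem real_mul_mem_unitDisk {r : ℝ} (h0 : 0 ≤ r) (h1 : r ≤ 1) {z : ℂ} (hz : z ∈ unitDisk) :
    (r : ℂ) * z ∈ unitDisk := by
  rw [mem_ball_zero_iff] at hz ⊢
  rw [norm_mul, Complex.norm_of_nonneg h0]
  nlinarith [norm_nonneg z]

theorem iteratedDeriv_comp_mul_left (f : ℂ → ℂ) (c : ℂ) (k : ℕ) :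
    iteratedDeriv k (fun z => f (c * z)) = fun z => c ^ k * iteratedDeriv k f (c * z) := by
  induction k with
  | zero => simp
  | succ k ih =>
    funext z
    rw [iteratedDeriv_succ, ih, deriv_const_mul_field, deriv_comp_mul_left, iteratedDeriv_succ,
      smul_eq_mul]
    ring

/-- The dilation `z ↦ F(rz)` is holomorphic on a disk larger than the unit disk. -/
theorem differentiableOn_dilation (F : Hol unitDisk) {r : ℝ} (h0 : 0 < r) (h1 : r < 1) :
    DifferentiableOn ℂ (fun z => extendZero (F : unitDisk → ℂ) (r * z))
      (closedBall 0 ((1 + 1 / r) / 2)) := by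
  refine (Hol.differentiableOn F).comp (by fun_prop) fun z hz => ?_
  rw [mem_closedBall_zero_iff] at hz
  rw [mem_ball_zero_iff, norm_mul, Complex.norm_of_nonneg h0.le]
  calc r * ‖z‖ ≤ r * ((1 + 1 / r) / 2) := by gcongr
    _ = (r + 1) / 2 := by field_simp
    _ < 1 := by linarith

/-- The k-th derivative gains a factor r^k ≤ 1, the weight satisfies v(z) ≤ v(rz), and the change of
variables costs r⁻². -/
theorem IsRegularWeight.weightedNormSq_dilation_le {v : ℂ → ℝ} (hv : IsRegularWeight v) (n : ℕ)
    {F G : Hol unitDisk} {r : ℝ} (h0 : 0 < r) (h1 : r < 1)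
    (hG : ∀ z (hz : z ∈ unitDisk), (G : unitDisk → ℂ) ⟨z, hz⟩ =
      extendZero (F : unitDisk → ℂ) (r * z)) :
    weightedNormSq v n G ≤ ENNReal.ofReal ((r ^ 2)⁻¹) * weightedNormSq v n F := by
  rw [weightedNormSq, weightedNormSq, Finset.mul_sum]
  refine Finset.sum_le_sum fun k _ => ?_
  change ∫⁻ z, ‖Hol.der k G z‖ₑ ^ 2 * ENNReal.ofReal (v z) ∂areaMeasure ≤
    ENNReal.ofReal ((r ^ 2)⁻¹) * ∫⁻ z, ‖Hol.der k F z‖ₑ ^ 2 * ENNReal.ofReal (v z) ∂areaMeasure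
  rw [areaMeasure, lintegral_smul_measure, lintegral_smul_measure, smul_eq_mul, smul_eq_mul,
    mul_left_comm, ← lintegral_indicator measurableSet_ball
      (fun z => ‖Hol.der k F z‖ₑ ^ 2 * ENNReal.ofReal (v z)), ← lintegral_comp_ofReal_mul _ h0]
  refine mul_le_mul' le_rfl (le_trans ?_ (setLIntegral_le_lintegral unitDisk _))
  refine setLIntegral_mono' measurableSet_ball fun z hz => ?_
  rw [indicator_of_mem (real_mul_mem_unitDisk h0.le h1.le hz), Hol.der_eqOn hG k hz,
    iteratedDeriv_comp_mul_left]
  gcongr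
  · rw [← Hol.der, enorm_mul, enorm_pow]
    refine mul_le_of_le_one_left' (pow_le_one' ?_ _)
    rw [← ofReal_norm, Complex.norm_of_nonneg h0.le]
    exact ENNReal.ofReal_le_one.2 h1.le
  · exact hv.le_dilation r h0 h1 z hz

/-- A bounded sequence in a closed subspace of a Hilbert space that converges along a separating
family of continuous functionals has its limit in the subspace. -/
theorem Submodule.mem_of_bounded_of_tendsto {H α : Type*} [NormedAddCommGroup H]
    [InnerProductSpace ℂ H] [CompleteSpace H] (Λ : α → H →L[ℂ] ℂ)
    (hΛ : ∀ x, (∀ a, Λ a x = 0) → x = 0) (K : Submodule ℂ H) (hK : IsClosed (K : Set H)) {u : ℕ → H}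
    {x : H} {M : ℝ} (hu : ∀ j, u j ∈ K) (hM : ∀ j, ‖u j‖ ≤ M)
    (ht : ∀ a, Tendsto (fun j => Λ a (u j)) atTop (𝓝 (Λ a x))) : x ∈ K := by
  have hcomp : CompleteSpace K := hK.completeSpace_coe
  -- Since K = K^⊥⊥, it suffices that x is orthogonal to every h in K^⊥. The Riesz representers of
  -- the Λ a span a dense subspace because the Λ a separate points; approximating h by their
  -- combinations and using boundedness of u passes ⟨h, u j⟩ = 0 to the limit.
  rw [← Submodule.orthogonal_orthogonal K, Submodule.mem_orthogonal]
  intro h hh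
  have huh : ∀ j, inner ℂ h (u j) = 0 := fun j => Submodule.inner_left_of_mem_orthogonal (hu j) hh
  let S : Submodule ℂ H := Submodule.span ℂ (range fun a => (InnerProductSpace.toDual ℂ H).symm (Λ a))
  have hS : ∀ s ∈ S, Tendsto (fun j => inner ℂ s (u j)) atTop (𝓝 (inner ℂ s x)) := by
    intro s hs
    induction hs using Submodule.span_induction with
    | mem s hs =>
      obtain ⟨a, rfl⟩ := hs
      simpa using ht a
    | zero => simp
    | add s t _ _ h1 h2 => simpa [inner_add_left] using h1.add h2
    | smul c s _ h1 => simpa [inner_smul_left] using h1.mul_const _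
  have hdense : S.topologicalClosure = ⊤ := by
    rw [Submodule.topologicalClosure_eq_top_iff, Submodule.eq_bot_iff]
    refine fun y hy => hΛ y fun a => ?_
    have := (Submodule.mem_orthogonal S y).1 hy _ (Submodule.subset_span (mem_range_self a))
    simpa using this
  have hh' : h ∈ closure (S : Set H) := by
    have : h ∈ S.topologicalClosure := hdense ▸ Submodule.mem_top
    exact this
  have hM0 : 0 ≤ M := (norm_nonneg _).trans (hM 0)
  rw [← norm_le_zero_iff]
  refine le_of_forall_pos_le_add fun ε hε => ?_
  obtain ⟨s, hs, hd⟩ := Metric.mem_closure_iff.1 hh' (ε / (M + ‖x‖ + 1)) (by positivity)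
  rw [dist_eq_norm] at hd
  have h1 : ‖inner ℂ s x‖ ≤ ‖h - s‖ * M := by
    refine le_of_tendsto (hS s hs).norm (Eventually.of_forall fun j => ?_)
    have : inner ℂ s (u j) = -inner ℂ (h - s) (u j) := by rw [inner_sub_left, huh]; ring
    rw [this, norm_neg]
    exact (norm_inner_le_norm _ _).trans (by gcongr; exact hM j)
  have h2 : ‖inner ℂ h x‖ ≤ ‖h - s‖ * M + ‖h - s‖ * ‖x‖ := by
    have : inner ℂ h x = inner ℂ s x + inner ℂ (h - s) x := by rw [inner_sub_left]; ring
    rw [this]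
    exact (norm_add_le _ _).trans (add_le_add h1 (norm_inner_le_norm _ _))
  rw [lt_div_iff₀ (by positivity)] at hd
  nlinarith [norm_nonneg (h - s)]

namespace IsWeightedSpace

variable {H : Type*} [NormedAddCommGroup H] [InnerProductSpace ℂ H] [CompleteSpace H]
  {ι : H →ₗ[ℂ] Hol unitDisk} {v : ℂ → ℝ} {n : ℕ}

/-- The dilations of x lie in the closure of the polynomials and are bounded in norm. They converge
to x only at points of the disk, but evaluations separate points, so the closed subspace contains x.
-/
theorem denseRange_poly (h : IsWeightedSpace ι v n) (hv : IsRegularWeight v)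
    (hι : Function.Injective ι) {pol : Polynomial ℂ →ₗ[ℂ] H}
    (hpol : ∀ p, ι (pol p) = polyHol unitDisk p) : DenseRange pol := by
  intro x
  -- The shift by 2 keeps r j ≥ 1/2, so r⁻² ≤ 4 and the dilations have norm at most 2‖x‖.
  let r : ℕ → ℝ := fun j => 1 - 1 / (j + 2)
  have hr0 : ∀ j, 1 / 2 ≤ r j := fun j => by
    have : (1 : ℝ) / (j + 2) ≤ 1 / 2 := by gcongr; linarith [j.cast_nonneg (α := ℝ)]
    simp only [r]; linarith
  have hrpos : ∀ j, 0 < r j := fun j => by linarith [hr0 j]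
  have hr1 : ∀ j, r j < 1 := fun j => by
    have : (0 : ℝ) < 1 / (j + 2) := by positivity
    simp only [r]; linarith
  have hlim : Tendsto r atTop (𝓝 1) := by
    have h1 : Tendsto (fun j : ℕ => 1 / ((j : ℝ) + 2)) atTop (𝓝 0) :=
      tendsto_const_nhds.div_atTop
        (tendsto_atTop_add_const_right _ _ tendsto_natCast_atTop_atTop)
    simpa [r] using h1.const_sub 1
  have hR : ∀ j, 1 < (1 + 1 / r j) / 2 := fun j => by
    have : 1 < 1 / r j := by rw [lt_div_iff₀ (hrpos j)]; linarith [hr1 j]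
    linarith
  have hd := fun j => differentiableOn_dilation (ι x) (hrpos j) (hr1 j)
  have hex : ∀ j, ∃ y : H, ∀ z (hz : z ∈ unitDisk), (ι y : unitDisk → ℂ) ⟨z, hz⟩ =
      extendZero (ι x : unitDisk → ℂ) (r j * z) := fun j => by
    have hdisk : unitDisk ⊆ closedBall 0 ((1 + 1 / r j) / 2) :=
      ball_subset_closedBall.trans (closedBall_subset_closedBall (hR j).le)
    obtain ⟨y, hy⟩ := h.exists_eq (hv.weightedNormSq_lt_top n
      (F := Hol.ofDifferentiableOn _ ((hd j).mono hdisk)) (fun _ _ => rfl) (hR j)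
      ((hd j).mono ball_subset_closedBall))
    exact ⟨y, fun z hz => by rw [hy]; rfl⟩
  choose u hu using hex
  choose Λ hΛ using fun w : unitDisk => h.exists_eval hv w.2
  refine Submodule.mem_of_bounded_of_tendsto (u := u) (M := 2 * ‖x‖) Λ (fun y hy => ?_)
    (LinearMap.range pol).topologicalClosure (Submodule.isClosed_topologicalClosure _)
    (fun j => h.mem_closure_poly hv hpol (hR j) (hd j) (hu j)) (fun j => ?_) fun w => ?_
  · refine hι (Subtype.ext (funext fun w => ?_))
    rw [map_zero, ← hΛ w y, hy w]
    rfl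
  · have h1 := hv.weightedNormSq_dilation_le n (hrpos j) (hr1 j) (hu j)
    rw [← h.2, ← h.2, ← ENNReal.ofReal_mul (by positivity),
      ENNReal.ofReal_le_ofReal_iff (by positivity)] at h1
    refine (abs_le_of_sq_le_sq' (h1.trans ?_) (by positivity)).2
    rw [mul_pow]
    gcongr
    rw [inv_le_comm₀ (by have := hrpos j; positivity) (by norm_num)]
    nlinarith [hr0 j]
  · have hc : ContinuousAt (extendZero (ι x : unitDisk → ℂ)) w :=
      ((Hol.differentiableOn (ι x)).differentiableAt (isOpen_ball.mem_nhds w.2)).continuousAt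
    have h1 : Tendsto (fun j => (r j : ℂ) * w) atTop (𝓝 (w : ℂ)) := by
      simpa using ((Complex.continuous_ofReal.tendsto 1).comp hlim).mul_const (w : ℂ)
    have h2 := hc.tendsto.comp h1
    simp only [hΛ]
    rw [extendZero_apply] at h2
    exact h2.congr fun j => (hu j w w.2).symm

theorem polynomialsDense (h : IsWeightedSpace ι v n) (hv : IsRegularWeight v)
    (hι : Function.Injective ι) : PolynomialsDense ι := by
  obtain ⟨pol, hpol⟩ := h.exists_poly hv hι
  refine ⟨fun p => ⟨pol p, hpol p⟩, (h.denseRange_poly hv hι hpol).mono ?_⟩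
  rintro _ ⟨p, rfl⟩
  exact ⟨p, hpol p⟩

end IsWeightedSpace

/-! ### The shift operator -/

/-- Multiplication by the coordinate. -/
noncomputable def mulZ : Hol unitDisk →ₗ[ℂ] Hol unitDisk where
  toFun F := Hol.ofDifferentiableOn (fun z => z * extendZero (F : unitDisk → ℂ) z)
    (differentiableOn_id.mul (Hol.differentiableOn F))
  map_add' F G := Subtype.ext <| funext fun z => by
    simp [Hol.ofDifferentiableOn, extendZero_apply, mul_add]
  map_smul' c F := Subtype.ext <| funext fun z => by
    simp [Hol.ofDifferentiableOn, extendZero_apply, mul_left_comm]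

theorem mulZ_apply (F : Hol unitDisk) (z : unitDisk) :
    (mulZ F : unitDisk → ℂ) z = z * (F : unitDisk → ℂ) z := by
  simp [mulZ, Hol.ofDifferentiableOn, extendZero_apply]

/-- Leibniz rule. At k = 0 the truncated k - 1 is harmless, since its coefficient vanishes. -/
theorem der_mulZ (k : ℕ) (F : Hol unitDisk) {z : ℂ} (hz : z ∈ unitDisk) :
    Hol.der k (mulZ F) z = z * Hol.der k F z + k * Hol.der (k - 1) F z := by
  rw [Hol.der_eqOn (F := mulZ F) (g := fun z => z * extendZero (F : unitDisk → ℂ) z)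
    (fun _ _ => rfl) k hz]
  induction k generalizing z with
  | zero => simp [Hol.der]
  | succ k ih =>
    have hev : iteratedDeriv k (fun z => z * extendZero (F : unitDisk → ℂ) z) =ᶠ[𝓝 z]
        fun z => z * Hol.der k F z + k * Hol.der (k - 1) F z := by
      filter_upwards [isOpen_ball.mem_nhds hz] with y hy using ih hy
    have hd : ∀ k, HasDerivAt (Hol.der k F) (Hol.der (k + 1) F z) z := fun k => by
      have := ((Hol.differentiableOn_der k F).differentiableAt (isOpen_ball.mem_nhds hz)).hasDerivAt
      rwa [Hol.der, ← iteratedDeriv_succ] at this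
    rw [iteratedDeriv_succ, hev.deriv_eq]
    refine (((hasDerivAt_id z).mul (hd k)).add ((hd (k - 1)).const_mul (k : ℂ))).deriv.trans ?_
    rcases k with _ | k
    · simp [add_comm]
    · simp only [id, Nat.add_sub_cancel]
      push_cast
      ring

/-- Each of the n + 1 summands is estimated by (a + nb)² ≤ 2a² + 2n²b², where |z| < 1 and k ≤ n. -/
theorem weightedNormSq_mulZ_le (v : ℂ → ℝ) (hvm : Measurable v) (n : ℕ) (F : Hol unitDisk) :
    weightedNormSq v n (mulZ F) ≤ (n + 1 : ℕ) * ((2 + 2 * n ^ 2) * weightedNormSq v n F) := by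
  refine (Finset.sum_le_card_nsmul (Finset.range (n + 1)) _ ((2 + 2 * n ^ 2) * weightedNormSq v n F)
    fun k hk => ?_).trans_eq (by rw [Finset.card_range, nsmul_eq_mul])
  have hkn : k ≤ n := Nat.lt_succ_iff.1 (Finset.mem_range.1 hk)
  let I : ℕ → ℝ≥0∞ := fun k => ∫⁻ z, ‖Hol.der k F z‖ₑ ^ 2 * ENNReal.ofReal (v z) ∂areaMeasure
  have hI : ∀ k ≤ n, I k ≤ weightedNormSq v n F := fun k hk =>
    Finset.single_le_sum (f := I) (fun _ _ => zero_le) (Finset.mem_range.2 (Nat.lt_succ_of_le hk))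
  have hm : ∀ k, AEMeasurable (fun z => ‖Hol.der k F z‖ₑ ^ 2 * ENNReal.ofReal (v z)) areaMeasure :=
    fun k => ((((Hol.aestronglyMeasurable_der k F).mono_ac
      areaMeasure_absolutelyContinuous).enorm.pow_const 2).mul hvm.ennreal_ofReal.aemeasurable)
  calc ∫⁻ z, ‖Hol.der k (mulZ F) z‖ₑ ^ 2 * ENNReal.ofReal (v z) ∂areaMeasure
      ≤ ∫⁻ z, 2 * (‖Hol.der k F z‖ₑ ^ 2 * ENNReal.ofReal (v z)) +
          2 * n ^ 2 * (‖Hol.der (k - 1) F z‖ₑ ^ 2 * ENNReal.ofReal (v z)) ∂areaMeasure := by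
        refine lintegral_mono_ae (ae_areaMeasure_of_forall fun z hz => ?_)
        rw [← mul_assoc, ← mul_assoc, ← add_mul]
        gcongr
        rw [der_mulZ k F hz]
        have h1 : ‖z * Hol.der k F z + k * Hol.der (k - 1) F z‖ ^ 2 ≤
            2 * ‖Hol.der k F z‖ ^ 2 + 2 * n ^ 2 * ‖Hol.der (k - 1) F z‖ ^ 2 := by
          have hz1 : ‖z‖ ≤ 1 := (mem_ball_zero_iff.1 hz).le
          have hkn' : (k : ℝ) ≤ n := by exact_mod_cast hkn
          have h2 : ‖z * Hol.der k F z + k * Hol.der (k - 1) F z‖ ≤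
              ‖Hol.der k F z‖ + n * ‖Hol.der (k - 1) F z‖ := by
            refine (norm_add_le _ _).trans (add_le_add ?_ ?_)
            · rw [norm_mul]
              exact mul_le_of_le_one_left (norm_nonneg _) hz1
            · rw [norm_mul, Complex.norm_natCast]
              gcongr
          calc _ ≤ (‖Hol.der k F z‖ + n * ‖Hol.der (k - 1) F z‖) ^ 2 := by gcongr
            _ ≤ _ := by nlinarith [sq_nonneg (‖Hol.der k F z‖ - n * ‖Hol.der (k - 1) F z‖)]
        have h3 := ENNReal.ofReal_le_ofReal h1
        rw [ENNReal.ofReal_add (by positivity) (by positivity), ENNReal.ofReal_mul (by positivity),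
          ENNReal.ofReal_mul (by positivity), ENNReal.ofReal_mul (by positivity)] at h3
        simpa [ENNReal.ofReal_norm_sq, ENNReal.ofReal_pow] using h3
    _ = 2 * I k + 2 * n ^ 2 * I (k - 1) := by
        rw [lintegral_add_left' ((hm k).const_mul _), lintegral_const_mul'' _ (hm k),
          lintegral_const_mul'' _ (hm (k - 1))]
    _ ≤ 2 * weightedNormSq v n F + 2 * n ^ 2 * weightedNormSq v n F := by
        gcongr
        exacts [hI k hkn, hI (k - 1) (by lia)]
    _ = _ := by rw [add_mul]

theorem IsWeightedSpace.shiftContinuous {H : Type*} [NormedAddCommGroup H] [InnerProductSpace ℂ H]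
    {ι : H →ₗ[ℂ] Hol unitDisk} {v : ℂ → ℝ} {n : ℕ} (h : IsWeightedSpace ι v n)
    (hv : IsRegularWeight v) (hι : Function.Injective ι) : ShiftContinuous ι := by
  have hle := weightedNormSq_mulZ_le v hv.measurable n
  have hr : ∀ x, (mulZ ∘ₗ ι) x ∈ LinearMap.range ι := fun x => by
    refine h.exists_eq ((hle (ι x)).trans_lt ?_)
    rw [← h.enorm_sq]
    exact ENNReal.mul_lt_top (by simp) (ENNReal.mul_lt_top
      (ENNReal.add_lt_top.2 ⟨by simp, ENNReal.mul_lt_top (by simp) (by simp)⟩) (by simp))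
  let S : H →ₗ[ℂ] H :=
    (LinearEquiv.ofInjective ι hι).symm.toLinearMap ∘ₗ (mulZ ∘ₗ ι).codRestrict _ hr
  have hS : ∀ x, ι (S x) = mulZ (ι x) := fun x =>
    congrArg Subtype.val (LinearEquiv.apply_symm_apply (LinearEquiv.ofInjective ι hι)
      ⟨mulZ (ι x), hr x⟩)
  refine ⟨S.mkContinuous √((n + 1) * (2 + 2 * n ^ 2)) fun x => ?_, fun x z => ?_⟩
  · have h1 := hle (ι x)
    have h2 : ((n + 1 : ℕ) : ℝ≥0∞) * ((2 + 2 * n ^ 2) * ENNReal.ofReal (‖x‖ ^ 2)) =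
        ENNReal.ofReal ((n + 1) * ((2 + 2 * n ^ 2) * ‖x‖ ^ 2)) := by
      rw [ENNReal.ofReal_mul (by positivity), ENNReal.ofReal_mul (by positivity),
        ENNReal.ofReal_add (by positivity) (by positivity),
        ENNReal.ofReal_add (by positivity) (by positivity), ENNReal.ofReal_mul (by positivity)]
      simp [ENNReal.ofReal_pow]
    rw [← hS, ← h.2, ← h.2, h2, ENNReal.ofReal_le_ofReal_iff (by positivity)] at h1
    refine (abs_le_of_sq_le_sq' ?_ (by positivity)).2
    rw [mul_pow, Real.sq_sqrt (by positivity), mul_assoc]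
    exact h1
  · rw [LinearMap.mkContinuous_apply, hS, mulZ_apply]

/-! ### Estimates for the weight `distWeight` -/

/-- Only an inequality, because z/|z| takes the value 0 at z = 0. -/
theorem norm_div_norm_le_one (z : ℂ) : ‖z / (‖z‖ : ℂ)‖ ≤ 1 := by
  rw [norm_div, Complex.norm_real, norm_norm]
  exact div_self_le_one _

theorem norm_div_norm_sub_self_le {z : ℂ} (hz : z ∈ unitDisk) :
    ‖z / (‖z‖ : ℂ) - z‖ ≤ 1 - ‖z‖ := by
  rw [mem_ball_zero_iff] at hz
  rcases eq_or_ne z 0 with rfl | h0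
  · simp
  have h : z / (‖z‖ : ℂ) - z = z / (‖z‖ : ℂ) * ((1 - ‖z‖ : ℝ) : ℂ) := by
    have : (‖z‖ : ℂ) ≠ 0 := by simpa using h0
    push_cast
    field_simp
  rw [h, norm_mul, Complex.norm_of_nonneg (by linarith)]
  exact mul_le_of_le_one_left (by linarith) (norm_div_norm_le_one z)

theorem isRegularWeight_distWeight {Γ : Set ℂ} (hΓ : Γ.Nonempty) :
    IsRegularWeight (distWeight Γ) where
  measurable := by
    have h1 : Measurable fun z : ℂ => infDist (z / (‖z‖ : ℂ)) Γ :=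
      (continuous_infDist_pt Γ).measurable.comp (by fun_prop)
    exact Real.measurable_exp.comp (h1.div (by fun_prop)).neg
  pos z := Real.exp_pos _
  le_one z hz := by
    rw [mem_ball_zero_iff] at hz
    rw [distWeight, Real.exp_le_one_iff, neg_nonpos]
    exact div_nonneg infDist_nonneg (by linarith)
  lower_bound r h0 h1 := by
    obtain ⟨γ, hγ⟩ := hΓ
    have hr : 0 < 1 - r := by linarith
    -- The extra -1 makes the lower bound strict.
    refine ⟨Real.exp (-((1 + ‖γ‖) / (1 - r)) - 1), Real.exp_pos _, fun z hz => ?_⟩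
    refine Real.exp_lt_exp.2 ?_
    have h2 : infDist (z / (‖z‖ : ℂ)) Γ ≤ 1 + ‖γ‖ := by
      refine (infDist_le_dist_of_mem hγ).trans ?_
      rw [dist_eq_norm]
      exact (norm_sub_le _ _).trans (by linarith [norm_div_norm_le_one z])
    have h3 : infDist (z / (‖z‖ : ℂ)) Γ / (1 - ‖z‖) ≤ (1 + ‖γ‖) / (1 - r) := by
      gcongr
    linarith
  le_dilation r h0 h1 z hz := by
    rw [mem_ball_zero_iff] at hz
    rcases eq_or_ne z 0 with rfl | hz0
    · simp
    have hn : ‖(r : ℂ) * z‖ = r * ‖z‖ := by rw [norm_mul, Complex.norm_of_nonneg h0.le]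
    have hu : (r : ℂ) * z / ((r * ‖z‖ : ℝ) : ℂ) = z / (‖z‖ : ℂ) := by
      push_cast
      exact mul_div_mul_left _ _ (by exact_mod_cast h0.ne')
    rw [distWeight, distWeight, hn, hu]
    refine Real.exp_le_exp.2 (neg_le_neg ?_)
    have : r * ‖z‖ ≤ ‖z‖ := mul_le_of_le_one_left (norm_nonneg _) h1.le
    exact div_le_div_of_nonneg_left infDist_nonneg (by linarith) (by linarith)

/-- The weight is bounded below on the disks of a Stolz angle with vertex in `Γ`. -/
theorem ball_subset_and_le_distWeight {Γ : Set ℂ} {w : ℂ} (hw : w ∈ Γ) (hw1 : ‖w‖ = 1) {t : ℝ}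
    (ht0 : 0 < t) (ht : t ≤ 1 / 2) :
    ball ((1 - t : ℝ) * w) (t / 2) ⊆ unitDisk ∧
      ∀ ζ ∈ ball ((1 - t : ℝ) * w : ℂ) (t / 2), Real.exp (-4) ≤ distWeight Γ ζ := by
  have hc : ‖((1 - t : ℝ) : ℂ) * w‖ = 1 - t := by
    rw [norm_mul, hw1, mul_one, Complex.norm_of_nonneg (by linarith)]
  have hn : ∀ ζ ∈ ball ((1 - t : ℝ) * w : ℂ) (t / 2), ‖ζ‖ < 1 - t / 2 := fun ζ hζ => by
    have h1 := norm_le_norm_add_norm_sub' ζ ((1 - t : ℝ) * w)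
    rw [mem_ball, dist_eq_norm] at hζ
    linarith
  have hsub : ball ((1 - t : ℝ) * w) (t / 2) ⊆ unitDisk := fun ζ hζ => by
    rw [mem_ball_zero_iff]
    linarith [hn ζ hζ]
  -- On the disk 1 - |ζ| > t/2, so |ζ - w| ≤ 3t/2 is at most 3(1 - |ζ|). The step from ζ/|ζ| to ζ
  -- adds 1 - |ζ|, which gives the 4.
  refine ⟨hsub, fun ζ hζ => Real.exp_le_exp.2 (neg_le_neg ?_)⟩
  have h1 := hn ζ hζ
  have h2 : ‖ζ - w‖ ≤ 3 * t / 2 := by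
    have h3 : ζ - w = (ζ - (1 - t : ℝ) * w) + (-t : ℝ) * w := by push_cast; ring
    have h4 : ‖((-t : ℝ) : ℂ) * w‖ = t := by
      rw [norm_mul, hw1, mul_one, Complex.norm_real, norm_neg, Real.norm_of_nonneg ht0.le]
    rw [mem_ball, dist_eq_norm] at hζ
    rw [h3]
    exact (norm_add_le _ _).trans (by linarith)
  have h3 : infDist (ζ / (‖ζ‖ : ℂ)) Γ ≤ 1 - ‖ζ‖ + ‖ζ - w‖ := by
    refine (infDist_le_dist_of_mem hw).trans ?_
    rw [dist_eq_norm]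
    exact (norm_sub_le_norm_sub_add_norm_sub _ ζ _).trans
      (add_le_add_left (norm_div_norm_sub_self_le (hsub hζ)) _)
  rw [div_le_iff₀ (by linarith)]
  linarith

/-- The exponent 6 is the square of the triple pole in the second derivative of 1/(c - z). For |w| >
1 the pole stays away from the disk. For |w| = 1, either z/|z| is far from w, and so is z from c, or
it is near w, hence far from Γ, and the exponential decay of the weight wins. -/
theorem exists_inv_norm_pow_mul_distWeight_le {Γ : Set ℂ} (hΓ : Γ.Nonempty) (hclosed : IsClosed Γ)
    {w : ℂ} (hw1 : 1 ≤ ‖w‖) (hw : w ∉ Γ ∩ sphere 0 1) :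
    ∃ M : ℝ, 0 ≤ M ∧ ∀ ε : ℝ, 0 < ε → ∀ z ∈ unitDisk,
      ‖w * (1 + ε : ℝ) - z‖⁻¹ ^ 6 * distWeight Γ z ≤ M := by
  have hv := isRegularWeight_distWeight hΓ
  have hlow : ∀ ε : ℝ, 0 < ε → ∀ z, ‖w‖ * (1 + ε) - ‖z‖ ≤ ‖w * (1 + ε : ℝ) - z‖ := fun ε hε z => by
    have := norm_sub_norm_le (w * (1 + ε : ℝ)) z
    rwa [norm_mul, Complex.norm_of_nonneg (by positivity)] at this
  rcases hw1.lt_or_eq with hlt | heq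
  · have hη : 0 < ‖w‖ - 1 := by linarith
    refine ⟨(‖w‖ - 1)⁻¹ ^ 6 * 1, by positivity, fun ε hε z hz => ?_⟩
    have h1 := hlow ε hε z
    have hz1 := mem_ball_zero_iff.1 hz
    gcongr
    · exact (hv.pos z).le
    · nlinarith
    · exact hv.le_one z hz
  · have hwΓ : w ∉ Γ := fun h => hw ⟨h, by simp [← heq]⟩
    have hδ : 0 < infDist w Γ := (hclosed.notMem_iff_infDist_pos hΓ).1 hwΓ
    set δ := infDist w Γ with hδ_def
    refine ⟨(6 / δ) ^ 6 * 1 + 720 * (2 / δ) ^ 6, by positivity, fun ε hε z hz => ?_⟩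
    have h1 := hlow ε hε z
    rw [← heq, one_mul] at h1
    have hz1 := mem_ball_zero_iff.1 hz
    set u : ℂ := z / (‖z‖ : ℂ) with hu
    by_cases hcase : δ / 2 ≤ ‖u - w‖
    · have h2 : ‖z - w‖ ≤ ‖w * (1 + ε : ℝ) - z‖ + ε := by
        have h3 : z - w = -(w * (1 + ε : ℝ) - z) + w * (ε : ℝ) := by push_cast; ring
        rw [h3]
        refine (norm_add_le _ _).trans_eq ?_
        rw [norm_neg, norm_mul, ← heq, Complex.norm_of_nonneg hε.le, one_mul]
      have h3 : ‖u - w‖ ≤ ‖u - z‖ + ‖z - w‖ := norm_sub_le_norm_sub_add_norm_sub _ _ _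
      have h4 := norm_div_norm_sub_self_le hz
      -- δ/2 is at most (1 - |z|) + |c - z| + ε with c = (1 + ε)w, and each of the three terms is at
      -- most |c - z|.
      have h5 : δ / 6 ≤ ‖w * (1 + ε : ℝ) - z‖ := by linarith
      have h6 : ‖w * (1 + ε : ℝ) - z‖⁻¹ ≤ 6 / δ := by
        rw [← inv_div]
        gcongr
      calc ‖w * (1 + ε : ℝ) - z‖⁻¹ ^ 6 * distWeight Γ z ≤ (6 / δ) ^ 6 * 1 := by
            gcongr
            exacts [(hv.pos z).le, hv.le_one z hz]
        _ ≤ _ := le_add_of_nonneg_right (by positivity)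
    · have h2 : δ / 2 ≤ infDist u Γ := by
        have h3 : δ ≤ infDist u Γ + dist w u := infDist_le_infDist_add_dist
        rw [dist_comm, dist_eq_norm] at h3
        linarith
      have hX : 0 < 1 - ‖z‖ := by linarith
      set y : ℝ := δ / 2 / (1 - ‖z‖) with hy
      have hy0 : 0 ≤ y := by positivity
      have h3 : distWeight Γ z ≤ (Real.exp y)⁻¹ := by
        rw [← Real.exp_neg]
        exact Real.exp_le_exp.2 (neg_le_neg (div_le_div_of_nonneg_right h2 hX.le))
      have h4 : ‖w * (1 + ε : ℝ) - z‖⁻¹ ≤ 2 / δ * y := by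
        have h5 : 2 / δ * y = (1 - ‖z‖)⁻¹ := by rw [hy]; field_simp
        rw [h5]
        gcongr
        linarith
      -- 720 = 6!, from the sixth term of the exponential series.
      have h5 : y ^ 6 * (Real.exp y)⁻¹ ≤ 720 := by
        have h6 := Real.pow_div_factorial_le_exp y hy0 6
        rw [← div_eq_mul_inv, div_le_iff₀ (Real.exp_pos y)]
        norm_num [Nat.factorial] at h6
        linarith
      calc ‖w * (1 + ε : ℝ) - z‖⁻¹ ^ 6 * distWeight Γ z ≤ (2 / δ * y) ^ 6 * (Real.exp y)⁻¹ := by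
            gcongr
            exact (hv.pos z).le
        _ = (2 / δ) ^ 6 * (y ^ 6 * (Real.exp y)⁻¹) := by ring
        _ ≤ (2 / δ) ^ 6 * 720 := by gcongr
        _ ≤ _ := by rw [mul_comm]; exact le_add_of_nonneg_left (by positivity)

theorem norm_iteratedDeriv_const_sub_inv (c z : ℂ) (k : ℕ) :
    ‖iteratedDeriv k (fun z => (c - z)⁻¹) z‖ = k.factorial * ‖c - z‖⁻¹ ^ (k + 1) := by
  have h : iteratedDeriv k (fun z : ℂ => z⁻¹) = fun z => (-1 : ℂ) ^ k * k.factorial * z ^ (-1 - k : ℤ) := by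
    rw [iteratedDeriv_eq_iterate]
    exact iter_deriv_inv' k
  rw [iteratedDeriv_comp_const_sub k (fun z : ℂ => z⁻¹), h]
  have h2 : (-1 - k : ℤ) = -((k + 1 : ℕ) : ℤ) := by push_cast; ring
  simp only [h2, zpow_neg, zpow_natCast]
  simp

/-! ### The maximal domain -/

namespace IsWeightedSpace

variable {H : Type*} [NormedAddCommGroup H] [InnerProductSpace ℂ H] {ι : H →ₗ[ℂ] Hol unitDisk}
  {v : ℂ → ℝ}

/-- Boundary evaluation at the vertex of a Stolz angle on which the weight is bounded below. -/
theorem exists_norm_eval_le (h : IsWeightedSpace ι v 2) {pol : Polynomial ℂ →ₗ[ℂ] H}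
    (hpol : ∀ p, ι (pol p) = polyHol unitDisk p) {w : ℂ} (hw1 : ‖w‖ = 1) {c : ℝ} (hc : 0 < c)
    (hv : ∀ t : ℝ, 0 < t → t ≤ 1 / 2 → ball ((1 - t : ℝ) * w) (t / 2) ⊆ unitDisk ∧
      ∀ ζ ∈ ball ((1 - t : ℝ) * w : ℂ) (t / 2), c ≤ v ζ) :
    ∃ C : ℝ, ∀ p, ‖p.eval w‖ ≤ C * ‖pol p‖ := by
  -- With B as below, |g(1/2)| ≤ 2B + B and the mean value inequality on [0, 1/2] adds B/2, in all
  -- at most 4B.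
  refine ⟨4 * (2 / √c), fun p => ?_⟩
  set B : ℝ := 2 / √c * ‖pol p‖ with hB
  have hsc : 0 < √c := Real.sqrt_pos.2 hc
  have hB0 : 0 ≤ B := by positivity
  have hder : ∀ k ≤ 2, ∀ t : ℝ, 0 < t → t ≤ 1 / 2 →
      t * ‖iteratedDeriv k (fun z => p.eval z) ((1 - t : ℝ) * w)‖ ≤ B := by
    intro k hk t ht0 ht
    obtain ⟨h1, h2⟩ := hv t ht0 ht
    have h3 := h.norm_der_le hk (pol p) (by positivity) hc h1 h2
    rw [hpol, der_polyHol k p (h1 (mem_ball_self (by positivity)))] at h3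
    calc _ ≤ t * ((√c * (t / 2))⁻¹ * ‖pol p‖) := by gcongr
      _ = B := by rw [hB]; field_simp
  have hp1 : iteratedDeriv 1 (fun z => p.eval z) = fun z => p.derivative.eval z := by
    funext z; simp
  have hp2 : iteratedDeriv 2 (fun z => p.eval z) = fun z => p.derivative.derivative.eval z := by
    rw [iteratedDeriv_succ, hp1]; funext z; simp
  -- Integration by parts in disguise: the correction term cancels p' in the derivative of g,
  -- leaving -t w² p'', which is bounded by B, while g(0) = p(w).
  set g : ℝ → ℂ := fun t => p.eval ((1 - t : ℝ) * w) + t * w * p.derivative.eval ((1 - t : ℝ) * w)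
    with hg
  have hlin : ∀ t : ℝ, HasDerivAt (fun t : ℝ => ((1 - t : ℝ) : ℂ) * w) (-w) t := fun t => by
    have h1 := (((hasDerivAt_id t).const_sub 1).ofReal_comp).mul_const w
    simpa using h1
  have hgd : ∀ t : ℝ, HasDerivAt g
      (-(t * w ^ 2 * p.derivative.derivative.eval ((1 - t : ℝ) * w))) t := by
    intro t
    have h0 := (p.hasDerivAt ((1 - t : ℝ) * w)).comp t (hlin t)
    have h1 := (p.derivative.hasDerivAt ((1 - t : ℝ) * w)).comp t (hlin t)
    have h2 : HasDerivAt (fun t : ℝ => (t : ℂ) * w) w t := by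
      simpa using (hasDerivAt_id t).ofReal_comp.mul_const w
    refine (h0.add (h2.mul h1)).congr_deriv ?_
    simp only [Function.comp]
    ring
  have hmv := norm_image_sub_le_of_norm_deriv_le_segment' (f := g) (a := 0) (b := 1 / 2) (C := B)
    (fun t _ => (hgd t).hasDerivWithinAt) (fun t ht => by
      rcases ht.1.eq_or_lt with rfl | h0
      · simpa using hB0
      · have h1 := hder 2 le_rfl t h0 ht.2.le
        rw [hp2] at h1
        rw [norm_neg, norm_mul, norm_mul, norm_pow, hw1, Complex.norm_of_nonneg h0.le]
        simpa using h1) (1 / 2) (right_mem_Icc.2 (by norm_num))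
  have h0 := hder 0 (by norm_num) (1 / 2) (by norm_num) le_rfl
  have h1 := hder 1 (by norm_num) (1 / 2) (by norm_num) le_rfl
  rw [iteratedDeriv_zero] at h0
  rw [hp1] at h1
  have hg0 : g 0 = p.eval w := by simp [hg]
  have hg1 : ‖g (1 / 2)‖ ≤ 2 * B + B := by
    refine (norm_add_le _ _).trans (add_le_add (by linarith) ?_)
    rw [norm_mul, norm_mul, hw1, mul_one, Complex.norm_of_nonneg (by norm_num)]
    exact h1
  rw [← hg0]
  have h2 := norm_sub_norm_le (g 0) (g (1 / 2))
  rw [norm_sub_rev] at h2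
  calc ‖g 0‖ ≤ 4 * B := by linarith
    _ = _ := by rw [hB]; ring

/-- A continuous extension Λ would take the value 1/(c - w) at the function 1/(c - z), c = (1 + ε)w.
The hypothesis on M bounds the norms of these functions uniformly in ε, while the values blow up as
ε → 0. -/
theorem notMem_maximalDomain (h : IsWeightedSpace ι v 2) (hv : IsRegularWeight v)
    {pol : Polynomial ℂ →ₗ[ℂ] H} (hpol : ∀ p, ι (pol p) = polyHol unitDisk p) {w : ℂ}
    (hw1 : 1 ≤ ‖w‖) {M : ℝ} (hM0 : 0 ≤ M) (hM : ∀ ε : ℝ, 0 < ε → ∀ z ∈ unitDisk,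
      ‖w * (1 + ε : ℝ) - z‖⁻¹ ^ 6 * v z ≤ M) :
    w ∉ maximalDomain ι := by
  rintro ⟨Λ, hΛ⟩
  set C : ℝ := (2 + 1) * areaMeasure.real univ * (4 * (1 + M)) with hC
  have hkey : ∀ ε : ℝ, 0 < ε → (‖w‖ * ε)⁻¹ ≤ ‖Λ‖ * √C := by
    intro ε hε
    set c : ℂ := w * (1 + ε : ℝ) with hc
    -- R lies strictly between |w| and |c|: Taylor polynomials of 1/(c - z) then converge at w as
    -- well as in the space.
    set R : ℝ := ‖w‖ * (1 + ε / 2) with hR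
    have hcn : ‖c‖ = ‖w‖ * (1 + ε) := by
      rw [hc, norm_mul, Complex.norm_of_nonneg (by positivity)]
    have hR1 : 1 < R := by rw [hR]; nlinarith
    have hG : DifferentiableOn ℂ (fun z => (c - z)⁻¹) (closedBall 0 R) := by
      refine ((differentiableOn_const c).sub differentiableOn_id).inv fun z hz h0 => ?_
      have h1 : c = z := sub_eq_zero.1 h0
      rw [mem_closedBall_zero_iff, ← h1, hcn, hR] at hz
      nlinarith
    have hdisk : unitDisk ⊆ closedBall 0 R :=
      ball_subset_closedBall.trans (closedBall_subset_closedBall hR1.le)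
    obtain ⟨x, hx⟩ := h.exists_eq (hv.weightedNormSq_lt_top 2
      (F := Hol.ofDifferentiableOn _ (hG.mono hdisk)) (fun _ _ => rfl) hR1
      (hG.mono ball_subset_closedBall))
    have hx' : ∀ z (hz : z ∈ unitDisk), (ι x : unitDisk → ℂ) ⟨z, hz⟩ = (c - z)⁻¹ :=
      fun z hz => by rw [hx]; rfl
    have hnorm : ‖x‖ ≤ √C := by
      refine Real.le_sqrt_of_sq_le (h.norm_sq_le (n := 2) (M := 4 * (1 + M)) (by positivity)
        fun k hk z hz => ?_)
      rw [Hol.der_eqOn hx' k hz, norm_iteratedDeriv_const_sub_inv]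
      set s : ℝ := ‖c - z‖⁻¹ with hs
      have hs0 : 0 ≤ s := by positivity
      have h1 : (s ^ (k + 1)) ^ 2 ≤ 1 + s ^ 6 := by
        rw [← pow_mul]
        rcases le_total s 1 with h1 | h1
        · exact (pow_le_one₀ hs0 h1).trans (le_add_of_nonneg_right (by positivity))
        · exact (pow_le_pow_right₀ h1 (by lia)).trans (le_add_of_nonneg_left zero_le_one)
      have h2 : (k.factorial : ℝ) ≤ 2 := by exact_mod_cast Nat.factorial_le hk
      calc (k.factorial * s ^ (k + 1)) ^ 2 * v z = (k.factorial : ℝ) ^ 2 * ((s ^ (k + 1)) ^ 2 * v z) := by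
            ring
        _ ≤ 2 ^ 2 * ((1 + s ^ 6) * v z) := by
            have := (hv.pos z).le
            gcongr
        _ = 4 * (v z + s ^ 6 * v z) := by ring
        _ ≤ 4 * (1 + M) := by
            gcongr
            exacts [hv.le_one z hz, hM ε hε z hz]
    obtain ⟨p, hp, hpw⟩ := h.exists_polynomial_tendsto hv hpol hR1 hG hx'
    have h1 : Tendsto (fun N => (p N).eval w) atTop (𝓝 (Λ x)) :=
      ((Λ.continuous.tendsto x).comp hp).congr fun N => hΛ _ _ (hpol (p N))
    have h2 : Λ x = (c - w)⁻¹ := tendsto_nhds_unique h1 (hpw w (by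
      rw [mem_ball_zero_iff, hR]; nlinarith))
    have h3 : c - w = w * (ε : ℝ) := by rw [hc]; push_cast; ring
    calc (‖w‖ * ε)⁻¹ = ‖Λ x‖ := by
          rw [h2, h3, norm_inv, norm_mul, Complex.norm_of_nonneg hε.le]
      _ ≤ ‖Λ‖ * ‖x‖ := Λ.le_opNorm x
      _ ≤ ‖Λ‖ * √C := by gcongr
  have hw0 : 0 < ‖w‖ := by linarith
  have hb : 0 ≤ ‖Λ‖ * √C := by positivity
  -- This ε makes the left side equal to the bound plus 1.
  have h1 := hkey (‖w‖ * (‖Λ‖ * √C + 1))⁻¹ (by positivity)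
  have h2 : (‖w‖ * (‖w‖ * (‖Λ‖ * √C + 1))⁻¹)⁻¹ = ‖Λ‖ * √C + 1 := by field_simp
  linarith

theorem maximalDomain_distWeight [CompleteSpace H] {Γ : Set ℂ} (hΓ : Γ.Nonempty)
    (hclosed : IsClosed Γ) (hι : Function.Injective ι) (h : IsWeightedSpace ι (distWeight Γ) 2) :
    maximalDomain ι = unitDisk ∪ (Γ ∩ sphere 0 1) := by
  have hv := isRegularWeight_distWeight hΓ
  obtain ⟨pol, hpol⟩ := h.exists_poly hv hι
  have hpol' : ∀ (p : Polynomial ℂ) (x : H), ι x = polyHol unitDisk p → x = pol p :=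
    fun p x hx => hι (hx.trans (hpol p).symm)
  ext w
  constructor
  · intro hw
    by_contra hcon
    rw [mem_union, not_or] at hcon
    have hw1 : 1 ≤ ‖w‖ := by simpa using hcon.1
    obtain ⟨M, hM0, hM⟩ := exists_inv_norm_pow_mul_distWeight_le hΓ hclosed hw1 hcon.2
    exact h.notMem_maximalDomain hv hpol hw1 hM0 hM hw
  · rintro (hw | ⟨hw, hw1⟩)
    · obtain ⟨Λ, hΛ⟩ := h.exists_eval hv hw
      refine ⟨Λ, fun p x hx => ?_⟩
      rw [hΛ, hx]
      rfl
    · rw [mem_sphere_zero_iff_norm] at hw1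
      have hC := h.exists_norm_eval_le hpol hw1 (Real.exp_pos (-4))
        fun t ht0 ht => ball_subset_and_le_distWeight hw hw1 ht0 ht
      -- Evaluation at w is bounded on the dense range of `pol`, so it extends by continuity.
      refine ⟨(Polynomial.leval w).extendOfNorm pol, fun p x hx => ?_⟩
      rw [hpol' p x hx]
      exact LinearMap.extendOfNorm_eq (h.denseRange_poly hv hι hpol) hC p

end IsWeightedSpace

/-! ### Assembly for nonempty and for empty Γ -/

theorem exists_space_of_distWeight {Γ : Set ℂ} (hΓ : Γ.Nonempty) (hclosed : IsClosed Γ) :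
    ∃ (H : Type) (_ : NormedAddCommGroup H) (_ : InnerProductSpace ℂ H) (_ : CompleteSpace H)
      (ι : H →ₗ[ℂ] Hol unitDisk),
      Function.Injective ι ∧
      PolynomialsDense ι ∧ EvaluationsContinuous ι ∧ ShiftContinuous ι ∧
      maximalDomain ι = unitDisk ∪ (Γ ∩ sphere 0 1) ∧ IsWeightedSpace ι (distWeight Γ) 2 := by
  have hv := isRegularWeight_distWeight hΓ
  obtain ⟨H, i1, i2, i3, ι, hι, h⟩ := hv.exists_isWeightedSpace 2
  exact ⟨H, i1, i2, i3, ι, hι, h.polynomialsDense hv hι, h.evaluationsContinuous hv,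
    h.shiftContinuous hv hι, h.maximalDomain_distWeight hΓ hclosed hι, h⟩

theorem theorem4p4 (Γ : Set ℂ) (hΓ : Γ ⊆ Metric.sphere (0 : ℂ) 1) (hclosed : IsClosed Γ) :
    ∃ (H : Type) (_ : NormedAddCommGroup H) (_ : InnerProductSpace ℂ H) (_ : CompleteSpace H)
      (ι : H →ₗ[ℂ] Hol unitDisk),
      Function.Injective ι ∧
      PolynomialsDense ι ∧ EvaluationsContinuous ι ∧ ShiftContinuous ι ∧
      maximalDomain ι = unitDisk ∪ Γ ∧
      (Γ.Nonempty →
        IsAdmissibleWeight (distWeight Γ) ∧ IsWeightedSpace ι (distWeight Γ) 2) := by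
  rcases Γ.eq_empty_or_nonempty with rfl | hne
  · obtain ⟨H, i1, i2, i3, ι, hι, h1, h2, h3, h4, -⟩ :=
      -- The point 2 is off the circle, so no boundary point is added. Γ = ∅ itself would not do:
      -- `infDist` to ∅ is 0, and the weight would be constantly 1.
      exists_space_of_distWeight (singleton_nonempty (2 : ℂ)) isClosed_singleton
    refine ⟨H, i1, i2, i3, ι, hι, h1, h2, h3, ?_, fun h => absurd h not_nonempty_empty⟩
    rw [h4, singleton_inter_eq_empty.2 (by simp)]
  · obtain ⟨H, i1, i2, i3, ι, hι, h1, h2, h3, h4, h5⟩ := exists_space_of_distWeight hne hclosed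
    refine ⟨H, i1, i2, i3, ι, hι, h1, h2, h3, ?_,
      fun _ => ⟨(isRegularWeight_distWeight hne).isAdmissibleWeight, h5⟩⟩
    rw [h4, inter_eq_left.2 hΓ]
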